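/- Theorem. Let $\nu\in\{2,3\}$, let $\Omega\subset\mathbb R^\nu$ be a bounded domain with Lipschitz boundary and outer unit normal $\mathbf n$, and let $0<T<\infty$. Let $\varepsilon,\rho,\gamma,M,\sigma>0$ and $0<\delta<1/2$ be constants. Let $W\in C^1((-\delta,1+\delta))$ be the (double-well) potential, and let the drag function $d=d(\cdot,\varepsilon)$ be continuous on $[0,1+\delta]$ and decreasing (not necessarily strictly) on $[0,1]$, with $d(0)>0$ and $d(1)=0$. Put $$\tilde\phi_f=2\delta+(1-2\delta)\phi,\quad \rho_f=\rho\phi,\quad \tilde\rho_f=\rho_f+\rho\delta,\quad \mathbf J=-M\varepsilon\nabla\mu,\quad \mathbf J_f=\rho\mathbf J,\quad \tilde{\mathbf S}=2\delta\sigma(1-\phi)\nabla\mu,\quad \nabla^s\mathbf v=\tfrac12(\nabla\mathbf v+\nabla\mathbf v^{\top}).$$ Let $(p,\mathbf v,\phi,\mu)$ be smooth on $\overline\Omega\times(0,T]$, with $\phi$ taking values in $(-\delta,1+\delta)$, and satisfy in $\Omega\times(0,T)$ $$\nabla\cdot(\tilde\phi_f\mathbf v)=0,$$ $$\partial_t(\tilde\rho_f\mathbf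 v)+\nabla\cdot\big((\rho_f\mathbf v+\mathbf J_f)\otimes\mathbf v\big)=-\tilde\phi_f\nabla p+\nabla\cdot(2\gamma\nabla^s\mathbf v)-\rho\, d(\tilde\phi_f)\mathbf v+\tilde{\mathbf S},$$ $$\partial_t\phi+\nabla\cdot(\phi\mathbf v+\mathbf J)=0,\qquad \mu=\frac{W'(\phi)}{\varepsilon}-\varepsilon\Delta\phi,$$ where $(\nabla\cdot A)_i=\sum_j\partial_jA_{ji}$ for matrix fields and $(\mathbf a\otimes\mathbf b)_{ij}=a_ib_j$, together with $\mathbf v=0$ on $\partial\Omega$ and $\nabla\phi\cdot\mathbf n=\nabla\mu\cdot\mathbf n=0$ at every point of $\partial\Omega$ where $\mathbf n$ exists, for all times in $(0,T)$. Then the free energy $$F(t)=\int_\Omega \tfrac12\tilde\rho_f|\mathbf v|^2+\sigma\Big(\frac{W(\phi)}{\varepsilon}+\frac{\varepsilon}{2}|\nabla\phi|^2\Big)\,dx$$ is well defined (its integrand is integrable) and differentiable at every $t\in(0,T]$ (from the left at $t=T$), with $$\frac{d}{dt}F(t)=\int_\Omega -2\gamma\,\nabla^s\mathbf v:\nabla\mathbf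 v-\rho\,d(\tilde\phi_f)|\mathbf v|^2-\sigma M\varepsilon|\nabla\mu|^2\,dx,$$ the integrand on the right being integrable. Moreover, the right-hand side is $\le 0$ at time $t$ whenever $\phi(\cdot,t)$ takes values in $[0,1]$ on $\Omega$, and also, for $\phi(\cdot,t)$ with values in $(-\delta,1+\delta)$, whenever $d\ge0$ on $[1,1+\delta]$ (for example for $d(s)=d_0(1-s)^2$ with a constant $d_0>0$). -/

import Mathlib

open MeasureTheory Set Topology
open scoped ContDiff InnerProductSpace Laplacian

noncomputable section

namespace CHNS

/-- The Euclidean space `ℝ^ν`. -/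
abbrev E (ν : ℕ) : Type := EuclideanSpace ℝ (Fin ν)

/-! ### Bounded Lipschitz domains and outer normals -/

/-- `Ω ⊆ ℝ^ν` is a bounded domain (nonempty, open, connected) with Lipschitz boundary: near every
boundary point, in suitable orthonormal coordinates `A y = (y', s) ∈ ℝ^(ν-1) × ℝ`, the set `Ω` is
the set of points strictly below the graph of a Lipschitz function `g`. -/
structure IsBoundedLipschitzDomain {ν : ℕ} (Ω : Set (E ν)) : Prop where
  isOpen : IsOpen Ω
  isConnected : IsConnected Ω
  isBounded : Bornology.IsBounded Ω
  exists_graph : ∀ x ∈ frontier Ω,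
    ∃ (A : E ν ≃ₗᵢ[ℝ] WithLp 2 (E (ν - 1) × ℝ)) (g : E (ν - 1) → ℝ) (K : NNReal),
      LipschitzWith K g ∧ ∀ᶠ y in 𝓝 x, (y ∈ Ω ↔ (A y).snd < g (A y).fst)

/-- `n` is an outer unit normal of `Ω` at `x`: up to errors of order `o(‖y - x‖)` as `y → x`, the
points `y` of `Ω` lie in the half-space `⟪y - x, n⟫ ≤ 0` and the points outside `Ω` lie in the
half-space `⟪y - x, n⟫ ≥ 0`. For a Lipschitz domain such an `n` is unique at every boundary point,
and it exists exactly where the local graph function is differentiable, hence at almost every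
boundary point; it is then the normalization of `(-∇g, 1)`. -/
def IsOuterUnitNormal {ν : ℕ} (Ω : Set (E ν)) (x n : E ν) : Prop :=
  ‖n‖ = 1 ∧ ∀ c : ℝ, 0 < c → ∀ᶠ y in 𝓝 x,
    (y ∈ Ω → ⟪y - x, n⟫_ℝ ≤ c * ‖y - x‖) ∧ (y ∉ Ω → -(c * ‖y - x‖) ≤ ⟪y - x, n⟫_ℝ)

/-- The homogeneous Neumann condition `∇f · n = 0` at all boundary points of `Ω` that have an outer
unit normal. The gradient at a boundary point is the gradient relative to the closure of `Ω`. -/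
def HomogeneousNeumann {ν : ℕ} (Ω : Set (E ν)) (f : E ν → ℝ) : Prop :=
  ∀ x ∈ frontier Ω, ∀ n : E ν, IsOuterUnitNormal Ω x n →
    ⟪gradientWithin f (closure Ω) x, n⟫_ℝ = 0

/-! ### Vector calculus -/

/-- The partial derivative `∂_j f (x)`. -/
def pderiv {ν : ℕ} (j : Fin ν) (f : E ν → ℝ) (x : E ν) : ℝ :=
  fderiv ℝ f x (EuclideanSpace.single j 1)

/-- The divergence `∇ · u = ∑_j ∂_j u_j` of a vector field. -/
def div {ν : ℕ} (u : E ν → E ν) (x : E ν) : ℝ :=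
  ∑ j, pderiv j (fun y => u y j) x

/-- The divergence of a matrix field, `(∇ · A)_i = ∑_j ∂_j A_{ji}`. -/
def matDiv {ν : ℕ} (A : E ν → Matrix (Fin ν) (Fin ν) ℝ) (x : E ν) : E ν :=
  WithLp.toLp 2 fun i => ∑ j, pderiv j (fun y => A y j i) x

/-- The Jacobian matrix `(∇v)_{ij} = ∂_j v_i`. -/
def jac {ν : ℕ} (v : E ν → E ν) (x : E ν) : Matrix (Fin ν) (Fin ν) ℝ :=
  Matrix.of fun i j => pderiv j (fun y => v y i) x

/-- The symmetric gradient `∇^s v = (∇v + (∇v)ᵀ) / 2`. -/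
def symGrad {ν : ℕ} (v : E ν → E ν) (x : E ν) : Matrix (Fin ν) (Fin ν) ℝ :=
  (1 / 2 : ℝ) • (jac v x + (jac v x).transpose)

/-- The Frobenius product `A : B = ∑_{i,j} A_{ij} B_{ij}`. -/
def frob {ν : ℕ} (A B : Matrix (Fin ν) (Fin ν) ℝ) : ℝ :=
  ∑ i, ∑ j, A i j * B i j

/-- The tensor product of vectors, `(a ⊗ b)_{ij} = a_i b_j`. -/
def tensor {ν : ℕ} (a b : E ν) : Matrix (Fin ν) (Fin ν) ℝ :=
  Matrix.of fun i j => a i * b j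

/-! ### The model -/

/-- The data of the two-phase model: interface parameter `ε`, regularization parameter `δ`, fluid
density `ρ`, viscosity `γ`, mobility `M`, surface tension coefficient `σ`, the potential `W`
and the drag function `d`, which stands for `d(·, ε)` at the given value of `ε`. The potential only
matters on `(-δ, 1 + δ)`, and it may blow up at the end points of that interval. -/
structure Data where
  ε : ℝ
  δ : ℝ
  ρ : ℝ
  γ : ℝ
  M : ℝ
  σ : ℝ
  W : ℝ → ℝ
  d : ℝ → ℝ
  ε_pos : 0 < ε
  δ_pos : 0 < δ
  δ_lt : δ < 1 / 2
  ρ_pos : 0 < ρ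
  γ_pos : 0 < γ
  M_pos : 0 < M
  σ_pos : 0 < σ
  W_contDiffOn : ContDiffOn ℝ 1 W (Ioo (-δ) (1 + δ))
  d_continuousOn : ContinuousOn d (Icc 0 (1 + δ))
  d_antitoneOn : AntitoneOn d (Icc 0 1)
  d_zero_pos : 0 < d 0
  d_one : d 1 = 0

/-- The unknowns, as functions of time and space: pressure `p`, velocity `v`, phase field `φ` and
chemical potential `μ`. -/
structure Fields (ν : ℕ) where
  p : ℝ → E ν → ℝ
  v : ℝ → E ν → E ν
  φ : ℝ → E ν → ℝ
  μ : ℝ → E ν → ℝ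

variable {ν : ℕ} (D : Data) (U : Fields ν)

/-- The fluid fraction `φ̃_f = 2δ + (1 - 2δ) φ`. -/
def phiF (t : ℝ) (x : E ν) : ℝ := 2 * D.δ + (1 - 2 * D.δ) * U.φ t x

/-- `ρ_f = ρ φ`. -/
def rhoF (t : ℝ) (x : E ν) : ℝ := D.ρ * U.φ t x

/-- `ρ̃_f = ρ_f + ρ δ`. -/
def rhoFTilde (t : ℝ) (x : E ν) : ℝ := rhoF D U t x + D.ρ * D.δ

/-- The Cahn-Hilliard flux `J = - M ε ∇μ`. -/
def flux (t : ℝ) (x : E ν) : E ν := -((D.M * D.ε) • gradient (U.μ t) x)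

/-- `J_f = ρ J`. -/
def fluxF (t : ℝ) (x : E ν) : E ν := D.ρ • flux D U t x

/-- The effective surface tension `S̃ = 2 δ σ (1 - φ) ∇μ`. -/
def surfaceTension (t : ℝ) (x : E ν) : E ν :=
  (2 * D.δ * D.σ * (1 - U.φ t x)) • gradient (U.μ t) x

/-- `U` is a smooth solution on `Ω × (0, T]` of the fluid-solid Cahn-Hilliard-Navier-Stokes model
with no-slip condition for `v` and homogeneous Neumann conditions for `φ` and `μ`. All fields are
smooth on `(0, T] × closure Ω`, the phase field takes values in `(-δ, 1 + δ)`, and the equations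
hold in `Ω × (0, T)`. -/
structure IsSmoothSolution (Ω : Set (E ν)) (T : ℝ) : Prop where
  smooth_p : ContDiffOn ℝ ∞ (fun z : ℝ × E ν => U.p z.1 z.2) (Ioc 0 T ×ˢ closure Ω)
  smooth_v : ContDiffOn ℝ ∞ (fun z : ℝ × E ν => U.v z.1 z.2) (Ioc 0 T ×ˢ closure Ω)
  smooth_φ : ContDiffOn ℝ ∞ (fun z : ℝ × E ν => U.φ z.1 z.2) (Ioc 0 T ×ˢ closure Ω)
  smooth_μ : ContDiffOn ℝ ∞ (fun z : ℝ × E ν => U.μ z.1 z.2) (Ioc 0 T ×ˢ closure Ω)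
  range_φ : ∀ t ∈ Ioc 0 T, ∀ x ∈ closure Ω, U.φ t x ∈ Ioo (-D.δ) (1 + D.δ)
  incompressibility : ∀ t ∈ Ioo 0 T, ∀ x ∈ Ω,
    div (fun y => phiF D U t y • U.v t y) x = 0
  momentum : ∀ t ∈ Ioo 0 T, ∀ x ∈ Ω,
    deriv (fun s => rhoFTilde D U s x • U.v s x) t
        + matDiv (fun y => tensor (rhoF D U t y • U.v t y + fluxF D U t y) (U.v t y)) x
      = -(phiF D U t x • gradient (U.p t) x)
        + matDiv (fun y => (2 * D.γ) • symGrad (U.v t) y) x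
        - (D.ρ * D.d (phiF D U t x)) • U.v t x
        + surfaceTension D U t x
  phase : ∀ t ∈ Ioo 0 T, ∀ x ∈ Ω,
    deriv (fun s => U.φ s x) t + div (fun y => U.φ t y • U.v t y + flux D U t y) x = 0
  potential : ∀ t ∈ Ioo 0 T, ∀ x ∈ Ω,
    U.μ t x = deriv D.W (U.φ t x) / D.ε - D.ε * (Δ (U.φ t)) x
  noSlip : ∀ t ∈ Ioo 0 T, ∀ x ∈ frontier Ω, U.v t x = 0
  neumann_φ : ∀ t ∈ Ioo 0 T, HomogeneousNeumann Ω (U.φ t)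
  neumann_μ : ∀ t ∈ Ioo 0 T, HomogeneousNeumann Ω (U.μ t)

/-! ### The free energy -/

/-- The Ginzburg-Landau energy density `f(φ, ξ) = σ (W(φ) / ε + ε |ξ|² / 2)`. -/
def glDensity (r : ℝ) (ξ : E ν) : ℝ :=
  D.σ * (D.W r / D.ε + D.ε / 2 * ‖ξ‖ ^ 2)

/-- The density of the free energy, `ρ̃_f |v|² / 2 + f(φ, ∇φ)`. -/
def energyDensity (t : ℝ) (x : E ν) : ℝ :=
  1 / 2 * rhoFTilde D U t x * ‖U.v t x‖ ^ 2 + glDensity D (U.φ t x) (gradient (U.φ t) x)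

/-- The free energy `F[φ(·,t), ∇φ(·,t), v(·,t)]`. -/
def freeEnergy (Ω : Set (E ν)) (t : ℝ) : ℝ := ∫ x in Ω, energyDensity D U t x

/-- The integrand `- 2γ ∇^s v : ∇v - ρ d(φ̃_f) |v|² - σ M ε |∇μ|²`. -/
def energyRate (t : ℝ) (x : E ν) : ℝ :=
  -(2 * D.γ * frob (symGrad (U.v t) x) (jac (U.v t) x))
    - D.ρ * D.d (phiF D U t x) * ‖U.v t x‖ ^ 2
    - D.σ * D.M * D.ε * ‖gradient (U.μ t) x‖ ^ 2

end CHNS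

end

namespace CHNS

open Filter

/-! ### Divergence of differentiable fields -/

section Divergence

variable {ν : ℕ}

/-! The energy law is a local identity: the time derivative of the energy density equals the
dissipation rate plus the divergence of a flux (`energyRate_add_div_energyFlux`). To see this, put
`q = φ v + J` and `w = φ̃_f v`, and test the momentum equation with `v`. Since `ρ̃_f` differs from
`ρ φ` by a constant, the phase equation gives `∂_t ρ̃_f + ∇ · (ρ q) = 0`, so inertia and convection
combine to `∂_t (ρ̃_f |v|² / 2) + ∇ · (|v|² ρ q / 2)`. As `∇ · w = 0`, the pressure contributes `-∇
· (p w)`. The Ginzburg-Landau part changes at the rate `σ μ ∂_t φ + σ ε ∇ · (∂_t φ ∇φ)`, and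
inserting the phase equation into `σ μ ∂_t φ` leaves, up to a divergence, `σ φ v · ∇μ - σ M ε
|∇μ|²`. The form of `S̃` is what closes the balance: `σ φ + 2 δ σ (1 - φ) = σ φ̃_f`, so the two
capillary terms add up to `σ w · ∇μ = σ ∇ · (μ w)`.

Every term of the flux contains `v`, `∇φ` or `∇μ`, so its normal component vanishes wherever a
normal exists. A divergence theorem for such fields suffices
(`IsBoundedLipschitzDomain.integral_div_eq_zero`), and it is proved without surface measure. Locally
`Ω = {h > 0}`, where `h` is Lipschitz and decreases at unit speed along a direction `e`. Integrate
by parts against a cutoff that is a function of `h`: its gradient has size `O(1/r)` and lives in a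
strip of volume `O(r)`. At almost every point `y` of the strip `h` is differentiable; its derivative
is constant along `e`, so it is normal to the boundary at the projection `z = y + h(y) e`. Hence
only `B y - B z` is seen, and this tends to `0` uniformly.

For `t < T` one differentiates under the integral, with bounds from compact time intervals away from
`0`; at `t = T` the derivative is the limit of the earlier ones. -/

lemma pderiv_congr {f g : E ν → ℝ} {x : E ν} (j : Fin ν) (h : f =ᶠ[𝓝 x] g) :
    pderiv j f x = pderiv j g x := by
  simp only [pderiv, h.fderiv_eq]

lemma div_congr {u w : E ν → E ν} {x : E ν} (h : u =ᶠ[𝓝 x] w) : div u x = div w x :=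
  Finset.sum_congr rfl fun j _ => pderiv_congr j (h.mono fun y hy => by simp only [hy])

lemma div_eq_zero_of_eventuallyEq {u : E ν → E ν} {x : E ν} (h : u =ᶠ[𝓝 x] 0) : div u x = 0 := by
  rw [div_congr h]
  simp [div, pderiv]

lemma fderiv_coord {u : E ν → E ν} {x : E ν} (h : DifferentiableAt ℝ u x) (j : Fin ν) (w : E ν) :
    fderiv ℝ (fun y => u y j) x w = fderiv ℝ u x w j := by
  have := ((EuclideanSpace.proj (𝕜 := ℝ) j).hasFDerivAt.comp x h.hasFDerivAt).fderiv
  have h2 : fderiv ℝ (fun y => u y j) x = (EuclideanSpace.proj (𝕜 := ℝ) j).comp (fderiv ℝ u x) :=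
    this
  rw [h2]; rfl

lemma div_eq_sum_fderiv {u : E ν → E ν} {x : E ν} (h : DifferentiableAt ℝ u x) :
    div u x = ∑ j, fderiv ℝ u x (EuclideanSpace.single j 1) j :=
  Finset.sum_congr rfl fun j _ => fderiv_coord h j _

lemma div_sum {ι : Type*} (s : Finset ι) {u : ι → E ν → E ν} {x : E ν}
    (h : ∀ i ∈ s, DifferentiableAt ℝ (u i) x) :
    div (fun y => ∑ i ∈ s, u i y) x = ∑ i ∈ s, div (u i) x := by
  rw [div_eq_sum_fderiv (DifferentiableAt.fun_sum h), fderiv_fun_sum h,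
    Finset.sum_congr rfl fun i hi => div_eq_sum_fderiv (h i hi), Finset.sum_comm]
  simp

lemma sum_apply_single_mul (L : E ν →L[ℝ] ℝ) (w : E ν) :
    ∑ j, L (EuclideanSpace.single j 1) * w j = L w := by
  have : w = ∑ j, w j • EuclideanSpace.single j (1 : ℝ) := by
    have := (EuclideanSpace.basisFun (Fin ν) ℝ).sum_repr w
    simpa using this.symm
  conv_rhs => rw [this, map_sum]
  simp [mul_comm]

/-- Integration by parts of a Lipschitz function against a compactly supported `C¹` field. -/
lemma integral_mul_div_eq_neg_integral_fderiv {η : E ν → ℝ} {L : NNReal} (hη : LipschitzWith L η)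
    {g : E ν → E ν} (hg : ContDiff ℝ 1 g) (hgs : HasCompactSupport g) :
    ∫ x, η x * div g x = -∫ x, fderiv ℝ η x (g x) := by
  have hgj : ∀ j, ContDiff ℝ 1 (fun y => g y j) := fun j => (contDiff_euclidean.1 hg) j
  have hgsj : ∀ j, HasCompactSupport (fun y => g y j) := fun j =>
    hgs.comp_left (g := fun v : E ν => v j) rfl
  have key : ∀ j : Fin ν, ∫ x, η x * pderiv j (fun y => g y j) x =
      -∫ x, lineDeriv ℝ η x (EuclideanSpace.single j 1) * g x j := by
    intro j
    -- A compactly supported `C¹` function is Lipschitz, so integration by parts for two Lipschitz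
    -- functions applies to each component.
    obtain ⟨D, hD⟩ := ContDiff.lipschitzWith_of_hasCompactSupport (hgsj j) (hgj j) one_ne_zero
    rw [hη.integral_lineDeriv_mul_eq hD (hgsj j), ← integral_neg]
    refine integral_congr_ae (Eventually.of_forall fun x => ?_)
    have : lineDeriv ℝ (fun y => g y j) x (-EuclideanSpace.single j 1)
        = -pderiv j (fun y => g y j) x := by
      rw [((hgj j).differentiable one_ne_zero x).lineDeriv_eq_fderiv]; simp [pderiv]
    simp only [this]; ring
  have hi1 : ∀ j : Fin ν, Integrable fun x => η x * pderiv j (fun y => g y j) x := by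
    intro j
    have hc : Continuous fun x => pderiv j (fun y => g y j) x :=
      ((hgj j).continuous_fderiv one_ne_zero).clm_apply continuous_const
    refine (hη.continuous.mul hc).integrable_of_hasCompactSupport ?_
    refine HasCompactSupport.mul_left ?_
    exact ((hgsj j).fderiv (𝕜 := ℝ)).comp_left
      (g := fun l : E ν →L[ℝ] ℝ => l (EuclideanSpace.single j 1)) rfl
  have hi2 : ∀ j : Fin ν, Integrable fun x =>
      lineDeriv ℝ η x (EuclideanSpace.single j 1) * g x j := by
    intro j
    refine Integrable.bdd_mul (c := L * ‖EuclideanSpace.single j (1 : ℝ)‖)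
      ((hgj j).continuous.integrable_of_hasCompactSupport (hgsj j))
      (measurable_lineDeriv hη.continuous).aestronglyMeasurable
      (Eventually.of_forall fun x => norm_lineDeriv_le_of_lipschitz ℝ hη)
  simp only [div, Finset.mul_sum]
  rw [integral_finsetSum _ fun j _ => hi1 j, Finset.sum_congr rfl fun j _ => key j,
    Finset.sum_neg_distrib, ← integral_finsetSum _ fun j _ => hi2 j]
  congr 1
  refine integral_congr_ae ?_
  -- Rademacher: almost everywhere the directional derivatives of `η` assemble into its Fréchet
  -- derivative.
  filter_upwards [hη.ae_differentiableAt (μ := volume)] with x hx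
  simp only [hx.lineDeriv_eq_fderiv]
  exact sum_apply_single_mul _ _

/-- `fderivWithin` supplies continuous values up to the boundary, where the two-sided derivatives in
`div` need not be meaningful. This is what makes `div B` integrable on a bounded `Ω`. -/
lemma continuousOn_div {Ω : Set (E ν)} (hΩ : IsOpen Ω) (hud : UniqueDiffOn ℝ (closure Ω))
    {B : E ν → E ν} (hB : ContDiffOn ℝ 1 B (closure Ω)) :
    ∃ f : E ν → ℝ, ContinuousOn f (closure Ω) ∧ EqOn (div B) f Ω := by
  refine ⟨fun x => ∑ j, fderivWithin ℝ B (closure Ω) x (EuclideanSpace.single j 1) j, ?_, ?_⟩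
  · have := hB.continuousOn_fderivWithin hud le_rfl
    fun_prop
  · intro x hx
    have hn : closure Ω ∈ 𝓝 x := mem_of_superset (hΩ.mem_nhds hx) subset_closure
    have hd : DifferentiableAt ℝ B x :=
      (hB.differentiableOn one_ne_zero).differentiableAt hn
    simp only [div_eq_sum_fderiv hd, fderivWithin_of_mem_nhds hn]

lemma integrableOn_of_continuousOn_closure {Ω : Set (E ν)} (hb : Bornology.IsBounded Ω)
    {f : E ν → ℝ} (hf : ContinuousOn f (closure Ω)) : IntegrableOn f Ω :=
  (hf.integrableOn_compact hb.isCompact_closure).mono_set subset_closure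

lemma integrableOn_div {Ω : Set (E ν)} (hΩ : IsOpen Ω) (hb : Bornology.IsBounded Ω)
    (hud : UniqueDiffOn ℝ (closure Ω)) {B : E ν → E ν} (hB : ContDiffOn ℝ 1 B (closure Ω)) :
    IntegrableOn (div B) Ω := by
  obtain ⟨f, hf, he⟩ := continuousOn_div hΩ hud hB
  exact (integrableOn_of_continuousOn_closure hb hf).congr_fun (fun x hx => (he hx).symm)
    hΩ.measurableSet

end Divergence

/-! ### Collars of the boundary -/

section Collar

variable {ν : ℕ}

/-- The function `h` describes `Ω` in `V` as the set where it is positive, its level sets have thin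
neighbourhoods, and its gradient is normal to the boundary at a nearby boundary point. -/
structure IsCollar (Ω V : Set (E ν)) (h : E ν → ℝ) (K : NNReal) (R C : ℝ) : Prop where
  R_pos : 0 < R
  isBounded : Bornology.IsBounded V
  lipschitz : LipschitzWith K h
  mem_iff : ∀ y ∈ V, (y ∈ Ω ↔ 0 < h y)
  strip_le : ∀ N : ℕ, 0 < N → volume.real (V ∩ {y | 0 < h y ∧ h y < R / N}) ≤ C / N
  exists_normal : ∀ y ∈ V, 0 < h y → h y < R → DifferentiableAt ℝ h y →
    ∃ z ∈ frontier Ω, ‖y - z‖ ≤ h y ∧ ∃ (n : E ν) (c : ℝ), IsOuterUnitNormal Ω z n ∧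
      ∀ u, fderiv ℝ h y u = c * ⟪u, n⟫_ℝ

/-- The cutoff which is `0` where `h ≤ r / 2`, is `1` where `r ≤ h`, and is affine in between. -/
noncomputable def cutoff (h : E ν → ℝ) (r : ℝ) (y : E ν) : ℝ := max 0 (min 1 (2 / r * h y - 1))

variable {h : E ν → ℝ} {K : NNReal} {r : ℝ}

lemma cutoff_lipschitz (hh : LipschitzWith K h) : ∃ L, LipschitzWith L (cutoff h r) := by
  have h1 : LipschitzWith (‖2 / r‖₊) (fun s : ℝ => 2 / r * s - 1) := by
    refine LipschitzWith.of_dist_le_mul fun a b => ?_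
    rw [Real.dist_eq, Real.dist_eq, coe_nnnorm, Real.norm_eq_abs, ← abs_mul]
    exact le_of_eq (by ring_nf)
  exact ⟨_, ((h1.comp hh).const_min 1).const_max 0⟩

lemma cutoff_nonneg (y : E ν) : 0 ≤ cutoff h r y := le_max_left _ _

lemma cutoff_le_one (y : E ν) : cutoff h r y ≤ 1 := max_le zero_le_one (min_le_left _ _)

lemma cutoff_eq_zero (hr : 0 < r) {y : E ν} (hy : h y ≤ r / 2) : cutoff h r y = 0 := by
  have : 2 / r * h y - 1 ≤ 0 := by
    have := mul_le_mul_of_nonneg_left hy (by positivity : 0 ≤ 2 / r)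
    have h2 : 2 / r * (r / 2) = 1 := by field_simp
    linarith
  exact max_eq_left ((min_le_right _ _).trans this)

lemma cutoff_eq_one (hr : 0 < r) {y : E ν} (hy : r ≤ h y) : cutoff h r y = 1 := by
  have : 1 ≤ 2 / r * h y - 1 := by
    have := mul_le_mul_of_nonneg_left hy (by positivity : 0 ≤ 2 / r)
    have h2 : 2 / r * r = 2 := by field_simp
    linarith
  rw [cutoff, min_eq_left this, max_eq_right zero_le_one]

/-- Off the open strip the cutoff attains its global minimum `0` or maximum `1`. This argument
covers the kinks as well, and needs no differentiability of `h`. -/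
lemma fderiv_cutoff_eq_zero (hr : 0 < r) {y : E ν} (hy : ¬(r / 2 < h y ∧ h y < r)) :
    fderiv ℝ (cutoff h r) y = 0 := by
  rcases le_or_gt (h y) (r / 2) with h1 | h1
  · refine IsLocalMin.fderiv_eq_zero (Eventually.of_forall fun z => ?_)
    rw [cutoff_eq_zero hr h1]; exact cutoff_nonneg z
  · have h2 : r ≤ h y := by
      by_contra h2; exact hy ⟨h1, not_le.1 h2⟩
    refine IsLocalMax.fderiv_eq_zero (Eventually.of_forall fun z => ?_)
    rw [cutoff_eq_one hr h2]; exact cutoff_le_one z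

lemma fderiv_cutoff_of_mem (hr : 0 < r) (hh : Continuous h) {y : E ν} (hd : DifferentiableAt ℝ h y)
    (hy : r / 2 < h y) (hy' : h y < r) :
    fderiv ℝ (cutoff h r) y = (2 / r) • fderiv ℝ h y := by
  have he : cutoff h r =ᶠ[𝓝 y] fun z => 2 / r * h z - 1 := by
    filter_upwards [hh.continuousAt.eventually (lt_mem_nhds hy),
      hh.continuousAt.eventually (gt_mem_nhds hy')] with z hz hz'
    have h1 := mul_lt_mul_of_pos_left hz (by positivity : 0 < 2 / r)
    have h2 := mul_lt_mul_of_pos_left hz' (by positivity : 0 < 2 / r)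
    have h3 : 2 / r * (r / 2) = 1 := by field_simp
    have h4 : 2 / r * r = 2 := by field_simp
    rw [cutoff, min_eq_right (by linarith), max_eq_right (by linarith)]
  rw [he.fderiv_eq]
  exact ((hd.hasFDerivAt.const_mul (2 / r)).sub_const 1).fderiv

lemma exists_cutoff_of_isCompact {S Ω : Set (E ν)} (hS : IsCompact S) (hΩ : IsOpen Ω)
    (hSΩ : S ⊆ Ω) : ∃ θ : E ν → ℝ, ContDiff ℝ ∞ θ ∧ HasCompactSupport θ ∧ tsupport θ ⊆ Ω ∧
      (∀ x ∈ S, θ =ᶠ[𝓝 x] 1) ∧ ∀ x, θ x ∈ Icc (0 : ℝ) 1 := by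
  obtain ⟨L, hL, hSL, hLΩ⟩ := exists_compact_between hS hΩ hSΩ
  obtain ⟨θ, h1, h0, hI⟩ := exists_contMDiffMap_one_nhds_of_subset_interior (n := ⊤)
    (modelWithCornersSelf ℝ (E ν)) hS.isClosed hSL
  have hsup : tsupport θ ⊆ L := by
    refine closure_minimal (fun x hx => ?_) hL.isClosed
    by_contra hxL
    exact hx (h0 x hxL)
  refine ⟨θ, θ.contMDiff.contDiff, hL.of_isClosed_subset (isClosed_tsupport _) hsup,
    hsup.trans hLΩ, fun x hx => ?_, hI⟩
  exact (eventually_nhdsSet_iff_forall.1 h1) x hx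

lemma contDiff_smul_of_tsupport_subset {Ω : Set (E ν)} (hΩ : IsOpen Ω) {θ : E ν → ℝ}
    (hθ : ContDiff ℝ 1 θ) (hs : tsupport θ ⊆ Ω) {B : E ν → E ν} (hB : ContDiffOn ℝ 1 B Ω) :
    ContDiff ℝ 1 (fun x => θ x • B x) := by
  rw [contDiff_iff_contDiffAt]
  intro x
  by_cases hx : x ∈ Ω
  · exact hθ.contDiffAt.smul (hB.contDiffAt (hΩ.mem_nhds hx))
  · have : (fun x => θ x • B x) =ᶠ[𝓝 x] fun _ => 0 := by
      have hx' : x ∉ tsupport θ := fun h => hx (hs h)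
      filter_upwards [notMem_tsupport_iff_eventuallyEq.1 hx'] with y hy
      simp [hy]
    exact contDiffAt_const.congr_of_eventuallyEq this

variable {Ω V : Set (E ν)} {R C : ℝ} {B : E ν → E ν}

/-- The derivative of `h` at `y` is a multiple of the pairing with a normal at a nearby boundary
point `z`, so it annihilates `B z`; only the oscillation `B y - B z` contributes. -/
lemma IsCollar.abs_fderiv_cutoff_le (hc : IsCollar Ω V h K R C) (hr : 0 < r) (hrR : r ≤ R)
    (hBn : ∀ z ∈ frontier Ω, ∀ n, IsOuterUnitNormal Ω z n → ⟪B z, n⟫_ℝ = 0)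
    {τ : ℝ} (hτ : ∀ y ∈ Ω, ∀ z ∈ frontier Ω, ‖y - z‖ ≤ r → ‖B y - B z‖ ≤ τ)
    {y : E ν} (hy : y ∈ V) (hd : DifferentiableAt ℝ h y) (h1 : r / 2 < h y) (h2 : h y < r) :
    |fderiv ℝ (cutoff h r) y (B y)| ≤ 2 / r * (K * τ) := by
  have hpos : 0 < h y := by linarith
  obtain ⟨z, hz, hyz, n, c, hn, hL⟩ := hc.exists_normal y hy hpos (by linarith) hd
  rw [fderiv_cutoff_of_mem hr hc.lipschitz.continuous hd h1 h2]
  have hBz : fderiv ℝ h y (B z) = 0 := by rw [hL, hBn z hz n hn, mul_zero]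
  have : fderiv ℝ h y (B y) = fderiv ℝ h y (B y - B z) := by rw [map_sub, hBz, sub_zero]
  rw [_root_.smul_apply, smul_eq_mul, abs_mul, abs_of_pos (by positivity : 0 < 2 / r),
    this]
  refine mul_le_mul_of_nonneg_left ?_ (by positivity)
  rw [← Real.norm_eq_abs]
  calc ‖fderiv ℝ h y (B y - B z)‖ ≤ ‖fderiv ℝ h y‖ * ‖B y - B z‖ :=
        ContinuousLinearMap.le_opNorm _ _
    _ ≤ K * τ := mul_le_mul (norm_fderiv_le_of_lipschitz ℝ hc.lipschitz)
        (hτ y ((hc.mem_iff y hy).2 hpos) z hz (by linarith)) (norm_nonneg _) K.2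

/-- The strip volume `C / N` compensates the slope `2 N / R` of the cutoff, so the bound depends on
`N` only through the oscillation `τ` of `B` at distance `R / N`. -/
lemma IsCollar.abs_integral_cutoff_mul_div_le (hc : IsCollar Ω V h K R C) (hΩ : IsOpen Ω)
    (hB : ContDiffOn ℝ 1 B Ω) (hBV : tsupport B ⊆ V)
    (hBn : ∀ z ∈ frontier Ω, ∀ n, IsOuterUnitNormal Ω z n → ⟪B z, n⟫_ℝ = 0)
    {N : ℕ} (hN : 0 < N) {τ : ℝ} (hτ0 : 0 ≤ τ)
    (hτ : ∀ y ∈ Ω, ∀ z ∈ frontier Ω, ‖y - z‖ ≤ R / N → ‖B y - B z‖ ≤ τ) :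
    |∫ x in Ω, cutoff h (R / N) x * div B x| ≤ 2 * K * C / R * τ := by
  have hN' : (0 : ℝ) < N := Nat.cast_pos.2 hN
  have hR := hc.R_pos
  set r := R / N with hr_def
  have hr : 0 < r := div_pos hR hN'
  have hrR : r ≤ R := div_le_self hR.le (by exact_mod_cast hN)
  have hcomp : IsCompact (tsupport B) :=
    Metric.isCompact_of_isClosed_isBounded (isClosed_tsupport _) (hc.isBounded.subset hBV)
  -- The cutoff times `div B` vanishes outside this compact subset of `Ω`. With a smooth `θ` equal
  -- to `1` near it, `B` may be replaced by `θ • B`, which is `C¹` on the whole space.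
  have hS : IsCompact (tsupport B ∩ {y | r / 2 ≤ h y}) :=
    hcomp.inter_right (isClosed_le continuous_const hc.lipschitz.continuous)
  have hSΩ : tsupport B ∩ {y | r / 2 ≤ h y} ⊆ Ω := fun y hy =>
    (hc.mem_iff y (hBV hy.1)).2 (lt_of_lt_of_le (by positivity) hy.2)
  obtain ⟨θ, hθ, hθc, hθΩ, hθ1, hθI⟩ := exists_cutoff_of_isCompact hS hΩ hSΩ
  have hg : ContDiff ℝ 1 (fun x => θ x • B x) :=
    contDiff_smul_of_tsupport_subset hΩ (hθ.of_le (by exact_mod_cast le_top)) hθΩ hB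
  have hgc : HasCompactSupport (fun x => θ x • B x) := hθc.smul_right
  obtain ⟨L, hL⟩ := cutoff_lipschitz (r := r) hc.lipschitz
  have hzero : ∀ x, x ∉ tsupport B → B =ᶠ[𝓝 x] 0 := fun x hx =>
    notMem_tsupport_iff_eventuallyEq.1 hx
  have hzero' : ∀ x, x ∉ tsupport B → (fun x => θ x • B x) =ᶠ[𝓝 x] 0 := fun x hx =>
    (hzero x hx).mono fun y hy => by simp [hy]
  have e1 : ∫ x in Ω, cutoff h r x * div B x
      = ∫ x in Ω, cutoff h r x * div (fun x => θ x • B x) x := by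
    refine setIntegral_congr_fun hΩ.measurableSet fun x _ => ?_
    by_cases hx : x ∈ tsupport B
    · rcases le_or_gt (h x) (r / 2) with h1 | h1
      · simp only [cutoff_eq_zero hr h1, zero_mul]
      · have : B =ᶠ[𝓝 x] fun x => θ x • B x :=
          (hθ1 x ⟨hx, h1.le⟩).mono fun y hy => by simp [hy]
        simp only [div_congr this]
    · simp only [div_eq_zero_of_eventuallyEq (hzero x hx),
        div_eq_zero_of_eventuallyEq (hzero' x hx)]
  have e2 : ∫ x in Ω, cutoff h r x * div (fun x => θ x • B x) x
      = ∫ x, cutoff h r x * div (fun x => θ x • B x) x := by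
    refine setIntegral_eq_integral_of_forall_compl_eq_zero fun x hx => ?_
    by_cases hxB : x ∈ tsupport B
    · have : ¬ 0 < h x := fun hp => hx ((hc.mem_iff x (hBV hxB)).2 hp)
      rw [cutoff_eq_zero hr (by linarith), zero_mul]
    · rw [div_eq_zero_of_eventuallyEq (hzero' x hxB), mul_zero]
  set S := V ∩ {y | 0 < h y ∧ h y < r} with hS_def
  have hSfin : volume S < ⊤ := (hc.isBounded.subset inter_subset_left).measure_lt_top
  -- `V` is not assumed measurable, so the dominating function lives on the measurable hull of the
  -- strip, which has the same volume.
  have hpt : ∀ᵐ x, ‖fderiv ℝ (cutoff h r) x (θ x • B x)‖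
      ≤ (toMeasurable volume S).indicator (fun _ => 2 / r * (K * τ)) x := by
    filter_upwards [hc.lipschitz.ae_differentiableAt (μ := volume)] with x hx
    have hnn : 0 ≤ (toMeasurable volume S).indicator (fun _ => 2 / r * (K * τ)) x :=
      indicator_nonneg (fun _ _ => by positivity) x
    by_cases hxB : x ∈ tsupport B
    · by_cases hm : r / 2 < h x ∧ h x < r
      · have hxS : x ∈ S := ⟨hBV hxB, by linarith [hm.1], hm.2⟩
        rw [indicator_of_mem (subset_toMeasurable _ _ hxS), map_smul, norm_smul,
          Real.norm_eq_abs, Real.norm_eq_abs, abs_of_nonneg (hθI x).1]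
        refine (mul_le_of_le_one_left (abs_nonneg _) (hθI x).2).trans ?_
        exact hc.abs_fderiv_cutoff_le hr hrR hBn hτ (hBV hxB) hx hm.1 hm.2
      · rw [fderiv_cutoff_eq_zero hr hm]; simpa using hnn
    · have : B x = 0 := image_eq_zero_of_notMem_tsupport hxB
      simpa [this] using hnn
  rw [e1, e2, integral_mul_div_eq_neg_integral_fderiv hL hg hgc, abs_neg]
  have hfin : volume (toMeasurable volume S) ≠ ⊤ := by rw [measure_toMeasurable]; exact hSfin.ne
  calc |∫ x, fderiv ℝ (cutoff h r) x (θ x • B x)|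
      ≤ ∫ x, (toMeasurable volume S).indicator (fun _ => 2 / r * (K * τ)) x :=
        norm_integral_le_of_norm_le
          ((integrable_indicator_iff (measurableSet_toMeasurable _ _)).2
            (integrableOn_const hfin)) hpt
    _ = volume.real S * (2 / r * (K * τ)) := by
        rw [integral_indicator (measurableSet_toMeasurable _ _), setIntegral_const, smul_eq_mul,
          Measure.real, measure_toMeasurable, Measure.real]
    _ ≤ C / N * (2 / r * (K * τ)) :=
        mul_le_mul_of_nonneg_right (hc.strip_le N hN) (by positivity)
    _ = 2 * K * C / R * τ := by rw [hr_def]; field_simp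

/-- The divergence theorem for fields supported in a collar. -/
lemma IsCollar.integral_div_eq_zero (hc : IsCollar Ω V h K R C) (hΩ : IsOpen Ω)
    (hb : Bornology.IsBounded Ω) (hud : UniqueDiffOn ℝ (closure Ω))
    (hB : ContDiffOn ℝ 1 B (closure Ω)) (hBV : tsupport B ⊆ V)
    (hBn : ∀ z ∈ frontier Ω, ∀ n, IsOuterUnitNormal Ω z n → ⟪B z, n⟫_ℝ = 0) :
    ∫ x in Ω, div B x = 0 := by
  have hR := hc.R_pos
  have hint := integrableOn_div hΩ hb hud hB
  have hlim : Tendsto (fun N : ℕ => ∫ x in Ω, cutoff h (R / (N + 1 : ℕ)) x * div B x) atTop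
      (𝓝 (∫ x in Ω, div B x)) := by
    refine tendsto_integral_of_dominated_convergence (fun x => ‖div B x‖) (fun N => ?_) hint.norm
      (fun N => Eventually.of_forall fun x => ?_) ?_
    · obtain ⟨L, hL⟩ := cutoff_lipschitz (r := R / (N + 1 : ℕ)) hc.lipschitz
      exact hL.continuous.aestronglyMeasurable.mul hint.aestronglyMeasurable
    · rw [norm_mul, Real.norm_eq_abs, abs_of_nonneg (cutoff_nonneg x)]
      exact mul_le_of_le_one_left (norm_nonneg _) (cutoff_le_one x)
    · refine (ae_restrict_iff' hΩ.measurableSet).2 (Eventually.of_forall fun x hx => ?_)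
      by_cases hxB : x ∈ tsupport B
      · have hpos := (hc.mem_iff x (hBV hxB)).1 hx
        have ht : Tendsto (fun N : ℕ => R / ((N + 1 : ℕ) : ℝ)) atTop (𝓝 0) :=
          (tendsto_const_div_atTop_nhds_zero_nat R).comp (tendsto_add_atTop_nat 1)
        refine tendsto_const_nhds.congr' ?_
        filter_upwards [ht.eventually (gt_mem_nhds hpos)] with N hN
        rw [cutoff_eq_one (by positivity) hN.le, one_mul]
      · rw [div_eq_zero_of_eventuallyEq (notMem_tsupport_iff_eventuallyEq.1 hxB)]
        simp
  have hzero : Tendsto (fun N : ℕ => ∫ x in Ω, cutoff h (R / (N + 1 : ℕ)) x * div B x) atTop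
      (𝓝 0) := by
    rw [Metric.tendsto_atTop]
    intro ε hε
    have huc := hb.isCompact_closure.uniformContinuousOn_of_continuous hB.continuousOn
    -- The added `1` makes `A` positive and strictly larger than the constant of the estimate.
    set A := |2 * K * C / R| + 1 with hA
    have hA0 : 0 < A := by positivity
    obtain ⟨δ, hδ, huc⟩ := Metric.uniformContinuousOn_iff.1 huc (ε / A) (by positivity)
    obtain ⟨N₀, hN₀⟩ := exists_nat_gt (R / δ)
    refine ⟨N₀, fun N hN => ?_⟩
    have hlt : R / ((N + 1 : ℕ) : ℝ) < δ := by
      rw [div_lt_iff₀ (by positivity)]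
      rw [div_lt_iff₀ hδ] at hN₀
      have : (N₀ : ℝ) ≤ (N + 1 : ℕ) := by exact_mod_cast Nat.le_succ_of_le hN
      nlinarith
    have := hc.abs_integral_cutoff_mul_div_le hΩ (hB.mono subset_closure) hBV hBn N.succ_pos
      (τ := ε / A) (by positivity) (fun y hy z hz hyz => by
        rw [← dist_eq_norm]
        refine (huc y (subset_closure hy) z (frontier_subset_closure hz) ?_).le
        rw [dist_eq_norm]; exact hyz.trans_lt hlt)
    rw [Real.dist_eq, sub_zero]
    refine this.trans_lt ?_
    have h1 : 2 * K * C / R < A := (le_abs_self _).trans_lt (lt_add_one _)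
    calc 2 * K * C / R * (ε / A) < A * (ε / A) := mul_lt_mul_of_pos_right h1 (by positivity)
      _ = ε := by field_simp
  exact tendsto_nhds_unique hlim hzero

end Collar

/-! ### Graph charts of Lipschitz domains -/

section Chart

variable {ν : ℕ}

/-- Near `x` the set `Ω` is the set where the Lipschitz function `h` is positive, and `h` decreases
at unit speed in the direction of the unit vector `e`. -/
structure IsGraphChart (Ω : Set (E ν)) (x : E ν) (h : E ν → ℝ) (e : E ν) (K : NNReal) (R : ℝ) :
    Prop where
  R_pos : 0 < R
  norm_eq : ‖e‖ = 1
  lipschitz : LipschitzWith K h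
  shift : ∀ y (t : ℝ), h (y + t • e) = h y - t
  mem_iff : ∀ y ∈ Metric.ball x (2 * R), (y ∈ Ω ↔ 0 < h y)

variable {Ω : Set (E ν)} {x : E ν}

lemma IsBoundedLipschitzDomain.exists_isGraphChart (hΩ : IsBoundedLipschitzDomain Ω)
    (hx : x ∈ frontier Ω) : ∃ h e K R, IsGraphChart Ω x h e K R := by
  obtain ⟨A, g, K, hg, hev⟩ := hΩ.exists_graph x hx
  obtain ⟨r, hr, hball⟩ := Metric.eventually_nhds_iff_ball.1 hev
  -- `h` is the height below the graph and `e` the vertical unit vector; the slope of `g` and the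
  -- vertical coordinate together give `K + 1`. Halving `r` leaves room for translations within the
  -- ball of radius `2 R`.
  refine ⟨fun y => g (A y).fst - (A y).snd, A.symm (WithLp.toLp 2 (0, 1)), K + 1, r / 2,
    by positivity, ?_, ?_, fun y t => ?_, fun y hy => ?_⟩
  · simp
  · refine LipschitzWith.of_dist_le_mul fun a b => ?_
    have h1 := (hg.dist_le_mul (A a).fst (A b).fst)
    have hn : ‖A a - A b‖ = ‖a - b‖ := by rw [← map_sub, LinearIsometryEquiv.norm_map]
    rw [Real.dist_eq, dist_eq_norm] at *
    have h3 : |(A a).snd - (A b).snd| ≤ ‖a - b‖ := hn ▸ WithLp.norm_snd_le (p := 2) _ (A a - A b)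
    have h4 : ‖(A a).fst - (A b).fst‖ ≤ ‖a - b‖ := hn ▸ WithLp.norm_fst_le (p := 2) _ (A a - A b)
    have h5 := mul_le_mul_of_nonneg_left h4 K.2
    rw [show g (A a).fst - (A a).snd - (g (A b).fst - (A b).snd)
      = (g (A a).fst - g (A b).fst) - ((A a).snd - (A b).snd) by ring]
    refine (abs_sub _ _).trans ?_
    push_cast
    simp only [NNReal.val_eq_coe] at h5
    linarith
  · simp [sub_sub]
  · rw [hball y (by rwa [mul_div_cancel₀ r two_ne_zero] at hy), sub_pos]

namespace IsGraphChart

variable {h : E ν → ℝ} {e : E ν} {K : NNReal} {R : ℝ}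

lemma fderiv_apply_dir (hc : IsGraphChart Ω x h e K R) {y : E ν} {L : E ν →L[ℝ] ℝ}
    (hL : HasFDerivAt h L y) : L e = -1 := by
  have h1 : HasDerivAt (fun t : ℝ => h (y + t • e)) (L e) 0 := by
    have h2 : HasDerivAt (fun t : ℝ => y + t • e) e 0 := by
      simpa using ((hasDerivAt_id (0 : ℝ)).smul_const e).const_add y
    have hL' : HasFDerivAt h L (y + (0 : ℝ) • e) := by simpa using hL
    exact hL'.comp_hasDerivAt (0 : ℝ) h2
  have h3 : HasDerivAt (fun t : ℝ => h (y + t • e)) (-1) 0 := by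
    simp only [hc.shift]
    simpa using (hasDerivAt_id (0 : ℝ)).const_sub (h y)
  exact h1.unique h3

/-- Translation along `e` changes `h` only by a constant. Differentiability at an interior point
thus carries over to the boundary point below which it lies, with the same derivative, and no
exceptional set on the boundary has to be discussed. -/
lemma hasFDerivAt_shift (hc : IsGraphChart Ω x h e K R) {y : E ν} {L : E ν →L[ℝ] ℝ}
    (hL : HasFDerivAt h L y) (s : ℝ) : HasFDerivAt h L (y + s • e) := by
  have he : h = fun w => h (w - s • e) - s := by
    funext w
    rw [← hc.shift (w - s • e) s, sub_add_cancel]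
  rw [he]
  have h1 : HasFDerivAt h L (y + s • e - s • e) := by simpa using hL
  have h2 : HasFDerivAt (fun w : E ν => w - s • e) (ContinuousLinearMap.id ℝ (E ν)) (y + s • e) :=
    (hasFDerivAt_id _).sub_const _
  simpa using (HasFDerivAt.comp (y + s • e) h1 h2).sub_const s

lemma mem_frontier (hc : IsGraphChart Ω x h e K R) (hΩ : IsOpen Ω) {z : E ν}
    (hz : z ∈ Metric.ball x (2 * R)) (h0 : h z = 0) : z ∈ frontier Ω := by
  rw [frontier, hΩ.interior_eq]
  refine ⟨?_, fun hzΩ => ((hc.mem_iff z hz).1 hzΩ).ne' h0⟩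
  -- Moving from `z` against `e` makes `h` positive, so `z` is a limit of points of `Ω`.
  have ht : Tendsto (fun t : ℝ => z + t • e) (𝓝[<] 0) (𝓝 z) := by
    have : Continuous fun t : ℝ => z + t • e := by fun_prop
    have h2 := this.tendsto 0
    simp only [zero_smul, add_zero] at h2
    exact h2.mono_left nhdsWithin_le_nhds
  refine mem_closure_of_tendsto ht ?_
  filter_upwards [ht.eventually (Metric.isOpen_ball.mem_nhds hz), self_mem_nhdsWithin] with t h1 h2
  rw [hc.mem_iff _ h1, hc.shift, h0]
  simpa using h2

/-- The sign of `h` decides membership in `Ω`, and its first-order expansion at `z` is the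
definition of a normal with `n = -∇h / |∇h|`. The gradient is nonzero because its component along
`e` is `-1`. -/
lemma isOuterUnitNormal (hc : IsGraphChart Ω x h e K R) {z : E ν}
    (hz : z ∈ Metric.ball x (2 * R)) (h0 : h z = 0) {L : E ν →L[ℝ] ℝ} (hL : HasFDerivAt h L z) :
    ∃ (n : E ν) (c : ℝ), IsOuterUnitNormal Ω z n ∧ ∀ u, L u = c * ⟪u, n⟫_ℝ := by
  set G := (InnerProductSpace.toDual ℝ (E ν)).symm L with hG
  have hLG : ∀ u, L u = ⟪G, u⟫_ℝ := fun u => (InnerProductSpace.toDual_symm_apply).symm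
  have hG0 : G ≠ 0 := by
    intro h
    have := hLG e
    rw [hc.fderiv_apply_dir hL, h, inner_zero_left] at this
    norm_num at this
  have hGn : 0 < ‖G‖ := norm_pos_iff.2 hG0
  have hLn : ∀ u, L u = -‖G‖ * ⟪u, -(‖G‖⁻¹ • G)⟫_ℝ := fun u => by
    rw [hLG, inner_neg_right, inner_smul_right, real_inner_comm]
    field_simp
  refine ⟨-(‖G‖⁻¹ • G), -‖G‖, ⟨?_, fun c hcpos => ?_⟩, hLn⟩
  · rw [norm_neg, norm_smul, norm_inv, norm_norm, inv_mul_cancel₀ hGn.ne']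
  · have ho := hL.isLittleO.def (c := c * ‖G‖) (by positivity)
    filter_upwards [ho, Metric.isOpen_ball.mem_nhds hz] with y hy hyb
    rw [h0, sub_zero, Real.norm_eq_abs, hLn] at hy
    obtain ⟨h1, h2⟩ := abs_le.1 hy
    constructor
    · intro hyΩ
      have := (hc.mem_iff y hyb).1 hyΩ
      refine le_of_mul_le_mul_left ?_ hGn
      linarith
    · intro hyΩ
      have : h y ≤ 0 := not_lt.1 fun hp => hyΩ ((hc.mem_iff y hyb).2 hp)
      refine le_of_mul_le_mul_left ?_ hGn
      linarith

/-- The `N` translates of the strip by `-(j R / N) e`, for `j < N`, occupy disjoint ranges of `h`,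
have equal volume and all lie in the ball of radius `2 R`. -/
lemma strip_le (hc : IsGraphChart Ω x h e K R) {N : ℕ} (hN : 0 < N) :
    volume.real (Metric.ball x R ∩ {y | 0 < h y ∧ h y < R / N})
      ≤ volume.real (Metric.ball x (2 * R)) / N := by
  have hN' : (0 : ℝ) < N := Nat.cast_pos.2 hN
  have hR := hc.R_pos
  set r := R / N with hr_def
  have hr : 0 < r := div_pos hR hN'
  set S := Metric.ball x R ∩ {y | 0 < h y ∧ h y < r}
  have hcont := hc.lipschitz.continuous
  have hS : MeasurableSet S := (Metric.isOpen_ball.inter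
    ((isOpen_lt continuous_const hcont).inter (isOpen_lt hcont continuous_const))).measurableSet
  let T : ℕ → Set (E ν) := fun j => (fun y => y + ((j : ℝ) * r) • e) ⁻¹' S
  have hT : ∀ j, MeasurableSet (T j) := fun j => hS.preimage (measurable_add_const _)
  have hTh : ∀ j, ∀ y ∈ T j, (j : ℝ) * r < h y ∧ h y < (j + 1) * r := by
    intro j y hy
    have h1 : 0 < h (y + ((j : ℝ) * r) • e) ∧ h (y + ((j : ℝ) * r) • e) < r := hy.2
    rw [hc.shift] at h1
    constructor <;> linarith [h1.1, h1.2]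
  have hdis : Set.PairwiseDisjoint (↑(Finset.range N)) T := by
    have haux : ∀ i j : ℕ, i < j → Disjoint (T i) (T j) := by
      intro i j hij
      refine Set.disjoint_left.2 fun y hi hj => ?_
      have h1 := (hTh i y hi).2
      have h2 := (hTh j y hj).1
      have h3 : ((i : ℝ) + 1) ≤ j := by exact_mod_cast hij
      nlinarith
    intro i _ j _ hij
    rcases lt_or_gt_of_ne hij with h1 | h1
    · exact haux i j h1
    · exact (haux j i h1).symm
  have hsub : (⋃ j ∈ Finset.range N, T j) ⊆ Metric.ball x (2 * R) := by
    refine iUnion₂_subset fun j hj y hy => ?_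
    have h1 : dist (y + ((j : ℝ) * r) • e) x < R := hy.1
    have h2 : (j : ℝ) * r ≤ R := by
      have : (j : ℝ) ≤ N := by exact_mod_cast (Finset.mem_range.1 hj).le
      rw [hr_def, mul_div_assoc', div_le_iff₀ hN']
      nlinarith
    have h3 : dist y (y + ((j : ℝ) * r) • e) = (j : ℝ) * r := by
      rw [dist_self_add_right, norm_smul, hc.norm_eq, mul_one, Real.norm_of_nonneg (by positivity)]
    rw [Metric.mem_ball]
    linarith [dist_triangle y (y + ((j : ℝ) * r) • e) x]
  have hmeas : (N : ENNReal) * volume S ≤ volume (Metric.ball x (2 * R)) := by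
    calc (N : ENNReal) * volume S = ∑ j ∈ Finset.range N, volume (T j) := by
          simp [T, measure_preimage_add_right]
      _ = volume (⋃ j ∈ Finset.range N, T j) :=
          (measure_biUnion_finset hdis fun j _ => hT j).symm
      _ ≤ _ := measure_mono hsub
  have := ENNReal.toReal_mono Metric.isBounded_ball.measure_lt_top.ne hmeas
  rw [ENNReal.toReal_mul, ENNReal.toReal_natCast] at this
  rw [le_div_iff₀ hN', mul_comm]
  exact this

lemma isCollar (hc : IsGraphChart Ω x h e K R) (hΩ : IsOpen Ω) :
    IsCollar Ω (Metric.ball x R) h K R (volume.real (Metric.ball x (2 * R))) where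
  R_pos := hc.R_pos
  isBounded := Metric.isBounded_ball
  lipschitz := hc.lipschitz
  mem_iff y hy := hc.mem_iff y (Metric.ball_subset_ball (by linarith [hc.R_pos]) hy)
  strip_le N hN := hc.strip_le hN
  exists_normal y hy hpos hlt hd := by
    have hn : ‖h y • e‖ = h y := by
      rw [norm_smul, hc.norm_eq, mul_one, Real.norm_of_nonneg hpos.le]
    have hz : y + h y • e ∈ Metric.ball x (2 * R) := by
      have h1 : dist (y + h y • e) y = h y := by rw [dist_self_add_left, hn]
      have h2 : dist y x < R := hy
      rw [Metric.mem_ball]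
      linarith [dist_triangle (y + h y • e) y x]
    have h0 : h (y + h y • e) = 0 := by rw [hc.shift, sub_self]
    refine ⟨y + h y • e, hc.mem_frontier hΩ hz h0, ?_,
      hc.isOuterUnitNormal hz h0 (hc.hasFDerivAt_shift hd.hasFDerivAt _)⟩
    rw [sub_add_cancel_left, norm_neg, hn]

/-- The closure contains a convex cone with apex `x` over a small ball around `x - τ e`, and a
convex set with interior points has unique derivatives at each point of its closure. -/
lemma uniqueDiffWithinAt (hc : IsGraphChart Ω x h e K R) (hx : x ∈ closure Ω) :
    UniqueDiffWithinAt ℝ (closure Ω) x := by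
  have hR := hc.R_pos
  have hhx : 0 ≤ h x := by
    by_contra hneg
    rw [not_le] at hneg
    have hev : ∀ᶠ y in 𝓝 x, y ∉ Ω := by
      filter_upwards [hc.lipschitz.continuous.continuousAt.eventually (gt_mem_nhds hneg),
        Metric.ball_mem_nhds x (by positivity : 0 < 2 * R)] with y h1 h2 h3
      exact absurd ((hc.mem_iff y h2).1 h3) (not_lt.2 h1.le)
    exact (mem_closure_iff_frequently.1 hx) hev
  set τ : ℝ := R / 2
  have hτ : 0 < τ := by positivity
  -- At cone parameter `s > 0` the axis raises `h` by `s τ` while the width lowers it by at most `s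
  -- K ρ`; `K ρ < τ` keeps `h` positive.
  obtain ⟨ρ, hρ, hρR, hKρ⟩ : ∃ ρ : ℝ, 0 < ρ ∧ ρ ≤ R ∧ K * ρ < τ := by
    refine ⟨min R (τ / (K + 1)), lt_min hR (by positivity), min_le_left _ _, ?_⟩
    calc (K : ℝ) * min R (τ / (K + 1)) ≤ K * (τ / (K + 1)) := by gcongr; exact min_le_right _ _
      _ < τ := by
        rw [mul_div_assoc', div_lt_iff₀ (by positivity)]
        nlinarith
  have hconv : Convex ℝ (convexJoin ℝ {x} (Metric.ball (x - τ • e) ρ)) :=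
    (convex_singleton x).convexJoin (convex_ball _ _)
  have hsub : Metric.ball (x - τ • e) ρ ⊆ convexJoin ℝ {x} (Metric.ball (x - τ • e) ρ) :=
    subset_convexJoin_right (singleton_nonempty x)
  have hu : UniqueDiffWithinAt ℝ (convexJoin ℝ {x} (Metric.ball (x - τ • e) ρ)) x := by
    refine uniqueDiffWithinAt_convex hconv ⟨x - τ • e, ?_⟩ (subset_closure ?_)
    · exact interior_mono hsub (by
        rw [Metric.isOpen_ball.interior_eq]; exact Metric.mem_ball_self hρ)
    · exact subset_convexJoin_left ⟨_, Metric.mem_ball_self hρ⟩ rfl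
  refine hu.mono fun y hy => ?_
  obtain ⟨a, ha, b, hb, a1, s, ha1, hs, has, rfl⟩ := mem_convexJoin.1 hy
  rw [mem_singleton_iff] at ha
  subst ha
  rcases hs.eq_or_lt with rfl | hs
  · have : a1 = 1 := by linarith
    simpa [this] using hx
  refine subset_closure ?_
  have hs1 : s ≤ 1 := by linarith
  set w := b - (a - τ • e) with hw
  have hwn : ‖w‖ < ρ := by rw [hw, ← dist_eq_norm]; exact hb
  have hy' : a1 • a + s • b = (a + s • w) + (-(s * τ)) • e := by
    have : b = w + a - τ • e := by rw [hw]; abel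
    rw [this]
    have ha1' : a1 = 1 - s := by linarith
    rw [ha1']
    module
  have hsw : ‖s • w‖ ≤ s * ρ := by
    rw [norm_smul, Real.norm_of_nonneg hs.le]; gcongr
  have hmem : a1 • a + s • b ∈ Metric.ball a (2 * R) := by
    rw [hy', Metric.mem_ball, add_assoc, dist_self_add_left]
    calc ‖s • w + (-(s * τ)) • e‖ ≤ ‖s • w‖ + ‖(-(s * τ)) • e‖ := norm_add_le _ _
      _ ≤ s * ρ + s * τ := by
          gcongr
          rw [norm_smul, hc.norm_eq, norm_neg, Real.norm_of_nonneg (by positivity), mul_one]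
      _ < 2 * R := by
          have : s * ρ ≤ R := by nlinarith
          have : s * τ ≤ R / 2 := mul_le_of_le_one_left hτ.le hs1
          linarith
  rw [hc.mem_iff _ hmem, hy', hc.shift]
  have hl := hc.lipschitz.dist_le_mul (a + s • w) a
  rw [dist_self_add_left, Real.dist_eq] at hl
  have h1 := (abs_le.1 hl).1
  have h2 : (K : ℝ) * ‖s • w‖ ≤ s * (K * ρ) := by
    calc (K : ℝ) * ‖s • w‖ ≤ K * (s * ρ) := by gcongr
      _ = s * (K * ρ) := by ring
  nlinarith

end IsGraphChart

lemma IsBoundedLipschitzDomain.uniqueDiffOn_closure (hΩ : IsBoundedLipschitzDomain Ω) :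
    UniqueDiffOn ℝ (closure Ω) := by
  intro x hx
  by_cases hxΩ : x ∈ Ω
  · exact uniqueDiffWithinAt_of_mem_nhds
      (mem_of_superset (hΩ.isOpen.mem_nhds hxΩ) subset_closure)
  · obtain ⟨h, e, K, R, hc⟩ := hΩ.exists_isGraphChart (x := x)
      ⟨hx, by rwa [hΩ.isOpen.interior_eq]⟩
    exact hc.uniqueDiffWithinAt hx

lemma IsBoundedLipschitzDomain.exists_isCollar (hΩ : IsBoundedLipschitzDomain Ω)
    (hx : x ∈ closure Ω) : ∃ V h K R C, IsOpen V ∧ x ∈ V ∧ IsCollar Ω V h K R C := by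
  by_cases hxΩ : x ∈ Ω
  -- At an interior point `Ω` itself serves as a collar: with `h = 1 = R` the strips are empty and
  -- the condition on normals is void.
  · refine ⟨Ω, fun _ => 1, 0, 1, 0, hΩ.isOpen, hxΩ, one_pos, hΩ.isBounded,
      LipschitzWith.const 1, fun y hy => by simp [hy], fun N hN => ?_, fun y _ _ h => by
        exact absurd h (lt_irrefl _)⟩
    have : Ω ∩ {y : E ν | (0 : ℝ) < 1 ∧ (1 : ℝ) < 1 / N} = ∅ := by
      ext y
      have : ¬ (1 : ℝ) < 1 / N := by
        rw [not_lt, div_le_one (by positivity)]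
        exact_mod_cast hN
      simp only [mem_inter_iff, mem_ofPred_eq, this, and_false, mem_empty_iff_false]
    rw [this]; simp
  · obtain ⟨h, e, K, R, hc⟩ := hΩ.exists_isGraphChart (x := x)
      ⟨hx, by rwa [hΩ.isOpen.interior_eq]⟩
    exact ⟨_, h, K, R, _, Metric.isOpen_ball, Metric.mem_ball_self hc.R_pos, hc.isCollar hΩ.isOpen⟩

/-- The divergence theorem on a bounded Lipschitz domain for `C¹` fields whose normal component
vanishes at all boundary points that have a normal. -/
theorem IsBoundedLipschitzDomain.integral_div_eq_zero (hΩ : IsBoundedLipschitzDomain Ω)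
    {B : E ν → E ν} (hB : ContDiffOn ℝ 1 B (closure Ω))
    (hBn : ∀ z ∈ frontier Ω, ∀ n, IsOuterUnitNormal Ω z n → ⟪B z, n⟫_ℝ = 0) :
    ∫ x in Ω, div B x = 0 := by
  have hud := hΩ.uniqueDiffOn_closure
  choose! V h K R C hV using fun x (hx : x ∈ closure Ω) => hΩ.exists_isCollar hx
  obtain ⟨s, hs, hcov⟩ := hΩ.isBounded.isCompact_closure.elim_nhds_subcover V fun x hx =>
    (hV x hx).1.mem_nhds (hV x hx).2.1
  obtain ⟨χ, hχ⟩ := SmoothPartitionOfUnity.exists_isSubordinate (modelWithCornersSelf ℝ (E ν))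
    (isClosed_closure (s := Ω)) (fun i : s => V i) (fun i => (hV i (hs i i.2)).1)
    (fun x hx => by simpa using hcov hx)
  have hχd : ∀ i, ContDiff ℝ 1 (χ i) := fun i =>
    (χ i).contMDiff.contDiff.of_le (by exact_mod_cast le_top)
  have hBi : ∀ i, ContDiffOn ℝ 1 (fun x => χ i x • B x) (closure Ω) := fun i =>
    (hχd i).contDiffOn.smul hB
  have hzero : ∀ i, ∫ x in Ω, div (fun x => χ i x • B x) x = 0 := by
    intro i
    refine (hV i (hs i i.2)).2.2.integral_div_eq_zero hΩ.isOpen hΩ.isBounded hud (hBi i) ?_ ?_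
    · exact (closure_mono (Function.support_smul_subset_left _ _)).trans (hχ i)
    · intro z hz n hn
      rw [inner_smul_left, hBn z hz n hn, mul_zero]
  have hsum : ∀ x ∈ Ω, B x = ∑ i, χ i x • B x := by
    intro x hx
    rw [← Finset.sum_smul]
    have := χ.sum_eq_one (subset_closure hx)
    rw [finsum_eq_sum_of_fintype] at this
    rw [this, one_smul]
  have hdiv : EqOn (div B) (fun x => ∑ i, div (fun x => χ i x • B x) x) Ω := by
    intro x hx
    have hn : closure Ω ∈ 𝓝 x := mem_of_superset (hΩ.isOpen.mem_nhds hx) subset_closure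
    have he : B =ᶠ[𝓝 x] fun y => ∑ i, χ i y • B y := by
      filter_upwards [hΩ.isOpen.mem_nhds hx] with y hy using hsum y hy
    rw [div_congr he]
    exact div_sum _ fun i _ => ((hBi i).differentiableOn one_ne_zero).differentiableAt hn
  rw [setIntegral_congr_fun hΩ.isOpen.measurableSet hdiv, integral_finsetSum _ fun i _ =>
    integrableOn_div hΩ.isOpen hΩ.isBounded hud (hBi i)]
  exact Finset.sum_eq_zero fun i _ => hzero i

end Chart

/-! ### Pointwise vector calculus -/

section Calculus

variable {ν : ℕ} {x : E ν}

lemma inner_eq_sum (a b : E ν) : ⟪a, b⟫_ℝ = ∑ i, a i * b i := by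
  simp [PiLp.inner_apply, mul_comm]

lemma gradient_coord (f : E ν → ℝ) (y : E ν) (j : Fin ν) : gradient f y j = pderiv j f y := by
  have h : ⟪gradient f y, EuclideanSpace.single j (1 : ℝ)⟫_ℝ = pderiv j f y := by
    rw [inner_gradient_left]; rfl
  rw [← h, EuclideanSpace.inner_single_right]
  simp

lemma contDiffAt_pderiv {f : E ν → ℝ} (hf : ContDiffAt ℝ ∞ f x) (j : Fin ν) :
    ContDiffAt ℝ ∞ (pderiv j f) x :=
  (hf.fderiv_right (m := ∞) le_rfl).clm_apply contDiffAt_const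

lemma contDiffAt_gradient {f : E ν → ℝ} (hf : ContDiffAt ℝ ∞ f x) :
    ContDiffAt ℝ ∞ (gradient f) x :=
  contDiffAt_euclidean.2 fun j => by
    simpa only [gradient_coord] using contDiffAt_pderiv hf j

lemma _root_.ContDiffAt.differentiableAt_top {F G : Type*} [NormedAddCommGroup F]
    [NormedSpace ℝ F] [NormedAddCommGroup G] [NormedSpace ℝ G] {f : F → G} {y : F}
    (hf : ContDiffAt ℝ ∞ f y) : DifferentiableAt ℝ f y :=
  hf.differentiableAt (by simp)

lemma pderiv_mul {f g : E ν → ℝ} (hf : DifferentiableAt ℝ f x) (hg : DifferentiableAt ℝ g x)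
    (j : Fin ν) : pderiv j (fun y => f y * g y) x = f x * pderiv j g x + pderiv j f x * g x := by
  simp only [pderiv, fderiv_fun_mul hf hg]
  simp [mul_comm]

lemma pderiv_const_mul {f : E ν → ℝ} (c : ℝ) (hf : DifferentiableAt ℝ f x) (j : Fin ν) :
    pderiv j (fun y => c * f y) x = c * pderiv j f x := by
  simp only [pderiv, fderiv_const_mul hf]
  simp

lemma pderiv_sum {ι : Type*} {s : Finset ι} {f : ι → E ν → ℝ}
    (hf : ∀ i ∈ s, DifferentiableAt ℝ (f i) x) (j : Fin ν) :
    pderiv j (fun y => ∑ i ∈ s, f i y) x = ∑ i ∈ s, pderiv j (f i) x := by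
  simp only [pderiv, fderiv_fun_sum hf]
  simp

lemma div_add {u w : E ν → E ν} (hu : DifferentiableAt ℝ u x) (hw : DifferentiableAt ℝ w x) :
    div (fun y => u y + w y) x = div u x + div w x := by
  rw [div_eq_sum_fderiv (hu.fun_add hw), div_eq_sum_fderiv hu, div_eq_sum_fderiv hw,
    fderiv_fun_add hu hw, ← Finset.sum_add_distrib]
  rfl

lemma div_sub {u w : E ν → E ν} (hu : DifferentiableAt ℝ u x) (hw : DifferentiableAt ℝ w x) :
    div (fun y => u y - w y) x = div u x - div w x := by
  rw [div_eq_sum_fderiv (hu.fun_sub hw), div_eq_sum_fderiv hu, div_eq_sum_fderiv hw,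
    fderiv_fun_sub hu hw, ← Finset.sum_sub_distrib]
  rfl

lemma differentiableAt_coord {u : E ν → E ν} (hu : DifferentiableAt ℝ u x) (j : Fin ν) :
    DifferentiableAt ℝ (fun y => u y j) x :=
  differentiableAt_euclidean.1 hu j

lemma contDiffAt_coord {u : E ν → E ν} {n : WithTop ℕ∞} (hu : ContDiffAt ℝ n u x) (j : Fin ν) :
    ContDiffAt ℝ n (fun y => u y j) x :=
  contDiffAt_euclidean.1 hu j

lemma div_smul {f : E ν → ℝ} {u : E ν → E ν} (hf : DifferentiableAt ℝ f x)
    (hu : DifferentiableAt ℝ u x) :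
    div (fun y => f y • u y) x = f x * div u x + ⟪gradient f x, u x⟫_ℝ := by
  simp only [div, PiLp.smul_apply, smul_eq_mul, pderiv_mul hf (differentiableAt_coord hu _),
    Finset.sum_add_distrib, Finset.mul_sum, inner_eq_sum, gradient_coord]

lemma div_const_smul {u : E ν → E ν} (c : ℝ) (hu : DifferentiableAt ℝ u x) :
    div (fun y => c • u y) x = c * div u x := by
  simp only [div, PiLp.smul_apply, smul_eq_mul, pderiv_const_mul c (differentiableAt_coord hu _),
    Finset.mul_sum]

lemma div_gradient {f : E ν → ℝ} (hf : ContDiffAt ℝ ∞ f x) : div (gradient f) x = (Δ f) x := by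
  rw [InnerProductSpace.laplacian_eq_iteratedFDeriv_orthonormalBasis f
    (EuclideanSpace.basisFun (Fin ν) ℝ)]
  refine Finset.sum_congr rfl fun j _ => ?_
  simp only [gradient_coord]
  have hd : DifferentiableAt ℝ (fderiv ℝ f) x :=
    (hf.fderiv_right (m := ∞) le_rfl).differentiableAt_top
  have : pderiv j (pderiv j f) x =
      fderiv ℝ (fderiv ℝ f) x (EuclideanSpace.single j 1) (EuclideanSpace.single j 1) := by
    have h := (hd.hasFDerivAt.clm_apply
      (hasFDerivAt_const (EuclideanSpace.single j (1 : ℝ)) x)).fderiv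
    unfold pderiv
    rw [h]
    simp
  rw [iteratedFDeriv_two_apply]
  simpa using this

lemma pderiv_half_norm_sq {v : E ν → E ν} (hv : DifferentiableAt ℝ v x) (j : Fin ν) :
    pderiv j (fun y => 1 / 2 * ‖v y‖ ^ 2) x = ∑ i, v x i * pderiv j (fun y => v y i) x := by
  have h1 : (fun y => 1 / 2 * ‖v y‖ ^ 2) = fun y => 1 / 2 * ∑ i, v y i * v y i := by
    funext y
    rw [← real_inner_self_eq_norm_sq, inner_eq_sum]
  have hd : ∀ i, DifferentiableAt ℝ (fun y => v y i) x := differentiableAt_coord hv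
  rw [h1, pderiv_const_mul _ (DifferentiableAt.fun_sum fun i _ => (hd i).fun_mul (hd i)),
    pderiv_sum fun i _ => (hd i).fun_mul (hd i), Finset.mul_sum]
  refine Finset.sum_congr rfl fun i _ => ?_
  rw [pderiv_mul (hd i) (hd i)]
  ring

/-- `v · (∇ · (m ⊗ v)) = (∇ · m) |v|² + m · ∇ (|v|² / 2)`. -/
lemma inner_matDiv_tensor {m v : E ν → E ν} (hm : DifferentiableAt ℝ m x)
    (hv : DifferentiableAt ℝ v x) :
    ⟪v x, matDiv (fun y => tensor (m y) (v y)) x⟫_ℝ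
      = div m x * ‖v x‖ ^ 2 + ⟪gradient (fun y => 1 / 2 * ‖v y‖ ^ 2) x, m x⟫_ℝ := by
  have hdv := differentiableAt_coord hv
  have hdm := differentiableAt_coord hm
  rw [← real_inner_self_eq_norm_sq]
  simp only [inner_eq_sum, gradient_coord, pderiv_half_norm_sq hv, matDiv, tensor,
    Matrix.of_apply, pderiv_mul (hdm _) (hdv _), div, Finset.mul_sum, Finset.sum_mul,
    Finset.sum_add_distrib, mul_add]
  rw [add_comm]
  congr 1
  · refine Finset.sum_congr rfl fun i _ => Finset.sum_congr rfl fun j _ => ?_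
    ring
  · rw [Finset.sum_comm]
    refine Finset.sum_congr rfl fun i _ => Finset.sum_congr rfl fun j _ => ?_
    ring

lemma symGrad_apply (v : E ν → E ν) (y : E ν) (i j : Fin ν) :
    symGrad v y i j = 1 / 2 * (pderiv j (fun z => v z i) y + pderiv i (fun z => v z j) y) := by
  simp [symGrad, jac]

lemma contDiffAt_symGrad {v : E ν → E ν} (hv : ContDiffAt ℝ ∞ v x) (i j : Fin ν) :
    ContDiffAt ℝ ∞ (fun y => symGrad v y i j) x := by
  simp only [symGrad_apply]
  exact contDiffAt_const.mul ((contDiffAt_pderiv (contDiffAt_coord hv i) j).add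
    (contDiffAt_pderiv (contDiffAt_coord hv j) i))

/-- `∇ · (A v) = v · (∇ · A) + A : ∇v` for the symmetric matrix field `A = ∇ˢ v`. -/
lemma div_symGrad_mulVec {v : E ν → E ν} (hv : ContDiffAt ℝ ∞ v x) :
    div (fun y => WithLp.toLp 2 ((symGrad v y).mulVec (v y))) x
      = ⟪v x, matDiv (symGrad v) x⟫_ℝ + frob (symGrad v x) (jac v x) := by
  have hS := fun i j => (contDiffAt_symGrad hv i j).differentiableAt_top
  have hd := differentiableAt_coord hv.differentiableAt_top
  simp only [div, inner_eq_sum, matDiv, frob, jac, Matrix.of_apply, Matrix.mulVec, dotProduct,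
    pderiv_sum fun j _ => (hS _ j).fun_mul (hd j), pderiv_mul (hS _ _) (hd _),
    Finset.sum_add_distrib, Finset.mul_sum]
  rw [add_comm]
  congr 1
  · rw [Finset.sum_comm]
    refine Finset.sum_congr rfl fun i _ => Finset.sum_congr rfl fun j _ => ?_
    ring
  · rw [Finset.sum_comm]
    refine Finset.sum_congr rfl fun i _ => Finset.sum_congr rfl fun j _ => ?_
    have : symGrad v x j i = symGrad v x i j := by simp only [symGrad_apply]; ring
    rw [this]

lemma matDiv_const_smul {A : E ν → Matrix (Fin ν) (Fin ν) ℝ} (c : ℝ)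
    (hA : ∀ i j, DifferentiableAt ℝ (fun y => A y i j) x) :
    matDiv (fun y => c • A y) x = c • matDiv A x := by
  ext i
  simp only [matDiv, Matrix.smul_apply, smul_eq_mul, pderiv_const_mul c (hA _ _), PiLp.smul_apply,
    Finset.mul_sum]

end Calculus

/-! ### The local energy balance -/

section LocalBalance

variable {ν : ℕ}

/-- The energy flux in terms of the values of the pressure, the phase field, the chemical potential,
the time derivative `ψ` of the phase field, the velocity, the gradients of the phase field and the
chemical potential, and the symmetric velocity gradient. -/
noncomputable def energyFlux (D : Data) (p φ μ ψ : ℝ) (v gφ gμ : E ν)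
    (S : Matrix (Fin ν) (Fin ν) ℝ) : E ν :=
  (2 * D.γ) • WithLp.toLp 2 (S.mulVec v)
    - (1 / 2 * ‖v‖ ^ 2) • (D.ρ • (φ • v + -((D.M * D.ε) • gμ)))
    - p • ((2 * D.δ + (1 - 2 * D.δ) * φ) • v)
    + (D.σ * D.ε) • (ψ • gφ)
    - D.σ • (μ • (φ • v + -((D.M * D.ε) • gμ)))
    + D.σ • (μ • ((2 * D.δ + (1 - 2 * D.δ) * φ) • v))

lemma inner_energyFlux_eq_zero (D : Data) (p φ μ ψ : ℝ) {v gφ gμ n : E ν}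
    (S : Matrix (Fin ν) (Fin ν) ℝ) (hv : v = 0) (hφ : ⟪gφ, n⟫_ℝ = 0) (hμ : ⟪gμ, n⟫_ℝ = 0) :
    ⟪energyFlux D p φ μ ψ v gφ gμ S, n⟫_ℝ = 0 := by
  subst hv
  simp [energyFlux, inner_add_left, inner_smul_left, hφ, hμ]

/-- The pointwise form of the energy balance: the time derivative of the energy density is the
dissipation rate plus the divergence of the energy flux. -/
lemma energyRate_add_div_energyFlux (D : Data) {x : E ν} {p φ μ ψ : E ν → ℝ} {v : E ν → E ν}
    (hp : ContDiffAt ℝ ∞ p x) (hφ : ContDiffAt ℝ ∞ φ x) (hμ : ContDiffAt ℝ ∞ μ x)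
    (hψ : ContDiffAt ℝ ∞ ψ x) (hv : ContDiffAt ℝ ∞ v x) (a : E ν) (dval Wval : ℝ)
    (incompressibility : div (fun y => (2 * D.δ + (1 - 2 * D.δ) * φ y) • v y) x = 0)
    (momentum : ((D.ρ * ψ x) • v x + (D.ρ * φ x + D.ρ * D.δ) • a)
        + matDiv (fun y => tensor ((D.ρ * φ y) • v y + D.ρ • -((D.M * D.ε) • gradient μ y)) (v y)) x
      = -((2 * D.δ + (1 - 2 * D.δ) * φ x) • gradient p x)
        + matDiv (fun y => (2 * D.γ) • symGrad v y) x
        - (D.ρ * dval) • v x + (2 * D.δ * D.σ * (1 - φ x)) • gradient μ x)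
    (phase : ψ x + div (fun y => φ y • v y + -((D.M * D.ε) • gradient μ y)) x = 0)
    (potential : μ x = Wval / D.ε - D.ε * (Δ φ) x) :
    1 / 2 * (D.ρ * ψ x) * ‖v x‖ ^ 2 + (D.ρ * φ x + D.ρ * D.δ) * ⟪v x, a⟫_ℝ
        + D.σ * (Wval * ψ x / D.ε + D.ε * ⟪gradient φ x, gradient ψ x⟫_ℝ)
      = -(2 * D.γ * frob (symGrad v x) (jac v x)) - D.ρ * dval * ‖v x‖ ^ 2
          - D.σ * D.M * D.ε * ‖gradient μ x‖ ^ 2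
        + div (fun y => energyFlux D (p y) (φ y) (μ y) (ψ y) (v y) (gradient φ y) (gradient μ y)
            (symGrad v y)) x := by
  have hgφ := contDiffAt_gradient hφ
  have hgμ := contDiffAt_gradient hμ
  set q : E ν → E ν := fun y => φ y • v y + -((D.M * D.ε) • gradient μ y) with hq
  set w : E ν → E ν := fun y => (2 * D.δ + (1 - 2 * D.δ) * φ y) • v y with hw
  have hqd : DifferentiableAt ℝ q x :=
    ((hφ.smul hv).add ((contDiffAt_const (c := D.M * D.ε)).smul hgμ).neg).differentiableAt_top
  have hwd : DifferentiableAt ℝ w x :=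
    ((contDiffAt_const.add (contDiffAt_const.mul hφ)).smul hv).differentiableAt_top
  have hn : ContDiffAt ℝ ∞ (fun y => 1 / 2 * ‖v y‖ ^ 2) x :=
    contDiffAt_const.mul (hv.norm_sq ℝ)
  have hSv : DifferentiableAt ℝ (fun y => WithLp.toLp 2 ((symGrad v y).mulVec (v y))) x := by
    refine differentiableAt_euclidean.2 fun i => ?_
    simp only [Matrix.mulVec, dotProduct]
    exact DifferentiableAt.fun_sum fun j _ =>
      (contDiffAt_symGrad hv i j).differentiableAt_top.fun_mul
        (differentiableAt_coord hv.differentiableAt_top j)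
  have hpd := hp.differentiableAt_top
  have hμd := hμ.differentiableAt_top
  have hψd := hψ.differentiableAt_top
  have hnd := hn.differentiableAt_top
  have hgφd := hgφ.differentiableAt_top
  have d1 := hSv.fun_const_smul (2 * D.γ)
  have d2 := hnd.fun_smul (hqd.fun_const_smul D.ρ)
  have d3 := hpd.fun_smul hwd
  have d4 := (hψd.fun_smul hgφd).fun_const_smul (D.σ * D.ε)
  have d5 := (hμd.fun_smul hqd).fun_const_smul D.σ
  have d6 := (hμd.fun_smul hwd).fun_const_smul D.σ
  have hdiv : div (fun y => energyFlux D (p y) (φ y) (μ y) (ψ y) (v y) (gradient φ y)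
      (gradient μ y) (symGrad v y)) x
      = 2 * D.γ * (⟪v x, matDiv (symGrad v) x⟫_ℝ + frob (symGrad v x) (jac v x))
        - (1 / 2 * ‖v x‖ ^ 2 * (D.ρ * div q x)
            + ⟪gradient (fun y => 1 / 2 * ‖v y‖ ^ 2) x, D.ρ • q x⟫_ℝ)
        - ⟪gradient p x, w x⟫_ℝ
        + D.σ * D.ε * (ψ x * (Δ φ) x + ⟪gradient ψ x, gradient φ x⟫_ℝ)
        - D.σ * (μ x * div q x + ⟪gradient μ x, q x⟫_ℝ)
        + D.σ * ⟪gradient μ x, w x⟫_ℝ := by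
    have e : div (fun y => energyFlux D (p y) (φ y) (μ y) (ψ y) (v y) (gradient φ y)
      (gradient μ y) (symGrad v y)) x = div (fun y =>
        (2 * D.γ) • WithLp.toLp 2 ((symGrad v y).mulVec (v y))
        - (1 / 2 * ‖v y‖ ^ 2) • (D.ρ • q y) - p y • w y + (D.σ * D.ε) • (ψ y • gradient φ y)
        - D.σ • (μ y • q y) + D.σ • (μ y • w y)) x := rfl
    rw [e, div_add (by exact (((d1.fun_sub d2).fun_sub d3).fun_add d4).fun_sub d5) d6,
      div_sub (by exact ((d1.fun_sub d2).fun_sub d3).fun_add d4) d5,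
      div_add (by exact (d1.fun_sub d2).fun_sub d3) d4, div_sub (by exact d1.fun_sub d2) d3,
      div_sub d1 d2, div_const_smul _ hSv, div_symGrad_mulVec hv,
      div_smul hnd (hqd.fun_const_smul D.ρ), div_const_smul _ hqd, div_smul hpd hwd,
      div_const_smul _ (hψd.fun_smul hgφd), div_smul hψd hgφd, div_gradient hφ,
      div_const_smul _ (hμd.fun_smul hqd), div_smul hμd hqd, div_const_smul _ (hμd.fun_smul hwd),
      div_smul hμd hwd, incompressibility]
    ring
  have hm : (fun y => tensor ((D.ρ * φ y) • v y + D.ρ • -((D.M * D.ε) • gradient μ y)) (v y))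
      = fun y => tensor (D.ρ • q y) (v y) := by
    funext y
    rw [hq]
    simp only [smul_add, smul_smul]
  have hmom := congrArg (fun u => ⟪v x, u⟫_ℝ) momentum
  simp only [hm, matDiv_const_smul _ fun i j => (contDiffAt_symGrad hv i j).differentiableAt_top,
    inner_add_right, inner_sub_right, inner_neg_right, inner_smul_right,
    inner_matDiv_tensor (hqd.fun_const_smul D.ρ) hv.differentiableAt_top, div_const_smul _ hqd,
    real_inner_self_eq_norm_sq] at hmom
  rw [hdiv]
  -- The phase and potential equations eliminate `div q` and `Wval`; afterwards only the tested
  -- momentum equation is left.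
  have hdq : div q x = -ψ x := by linarith
  have hW : Wval / D.ε = μ x + D.ε * (Δ φ) x := by linarith
  have hW' : Wval * ψ x / D.ε = (μ x + D.ε * (Δ φ) x) * ψ x := by rw [← hW]; ring
  have hqx : ⟪gradient μ x, q x⟫_ℝ
      = φ x * ⟪v x, gradient μ x⟫_ℝ - D.M * D.ε * ‖gradient μ x‖ ^ 2 := by
    rw [hq]
    simp only [inner_add_right, inner_neg_right, inner_smul_right, real_inner_self_eq_norm_sq,
      real_inner_comm (v x)]
    ring
  have hwx : ∀ u, ⟪u, w x⟫_ℝ = (2 * D.δ + (1 - 2 * D.δ) * φ x) * ⟪v x, u⟫_ℝ := fun u => by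
    rw [hw]
    simp only [inner_smul_right, real_inner_comm (v x)]
  simp only [hdq, inner_smul_right] at hmom ⊢
  rw [hW', hqx, hwx, hwx, real_inner_comm (gradient φ x)]
  -- Here `φ` from the phase flux and `2 δ (1 - φ)` from the surface tension add up to the factor `2
  -- δ + (1 - 2 δ) φ` of `w`.
  linear_combination hmom

end LocalBalance

/-! ### Functions that are smooth up to the boundary of a space-time cylinder -/

section Cylinder

variable {ν : ℕ} {Ω : Set (E ν)} {T : ℝ}

lemma uniqueDiffOn_cylinder (hud : UniqueDiffOn ℝ (closure Ω)) :
    UniqueDiffOn ℝ (Ioc 0 T ×ˢ closure Ω) :=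
  (uniqueDiffOn_Ioc 0 T).prod hud

lemma cylinder_mem_nhds (hΩ : IsOpen Ω) {t : ℝ} (ht : t ∈ Ioo 0 T) {x : E ν} (hx : x ∈ Ω) :
    Ioc 0 T ×ˢ closure Ω ∈ 𝓝 (t, x) :=
  prod_mem_nhds (mem_of_superset (isOpen_Ioo.mem_nhds ht) Ioo_subset_Ioc_self)
    (mem_of_superset (hΩ.mem_nhds hx) subset_closure)

lemma closure_mem_nhds (hΩ : IsOpen Ω) {x : E ν} (hx : x ∈ Ω) : closure Ω ∈ 𝓝 x :=
  mem_of_superset (hΩ.mem_nhds hx) subset_closure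

variable {F : Type*} [NormedAddCommGroup F] [NormedSpace ℝ F] {f : ℝ × E ν → F}

lemma contDiffOn_slice {n : WithTop ℕ∞} (hf : ContDiffOn ℝ n f (Ioc 0 T ×ˢ closure Ω)) {t : ℝ}
    (ht : t ∈ Ioc 0 T) : ContDiffOn ℝ n (fun x => f (t, x)) (closure Ω) :=
  hf.comp (contDiff_const.prodMk contDiff_id).contDiffOn fun _ hx => ⟨ht, hx⟩

lemma continuousOn_slice {g : ℝ × E ν → ℝ} (hg : ContinuousOn g (Ioc 0 T ×ˢ closure Ω)) {t : ℝ}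
    (ht : t ∈ Ioc 0 T) : ContinuousOn (fun x => g (t, x)) (closure Ω) :=
  hg.comp (Continuous.continuousOn (by fun_prop)) fun _ hx => ⟨ht, hx⟩

lemma fderivWithin_slice (hud : UniqueDiffOn ℝ (closure Ω))
    (hf : DifferentiableOn ℝ f (Ioc 0 T ×ˢ closure Ω)) {t : ℝ} (ht : t ∈ Ioc 0 T) {x : E ν}
    (hx : x ∈ closure Ω) (w : E ν) :
    fderivWithin ℝ (fun y => f (t, y)) (closure Ω) x w
      = fderivWithin ℝ f (Ioc 0 T ×ˢ closure Ω) (t, x) (0, w) := by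
  have h1 := (hf (t, x) ⟨ht, hx⟩).hasFDerivWithinAt
  have h2 : HasFDerivWithinAt (fun y : E ν => (t, y)) (ContinuousLinearMap.inr ℝ ℝ (E ν))
      (closure Ω) x := (hasFDerivAt_prodMk_right t x).hasFDerivWithinAt
  have h3 := HasFDerivWithinAt.comp x h1 h2 fun y hy => ⟨ht, hy⟩
  have h4 := h3.fderivWithin (hud x hx)
  rw [show (fun y => f (t, y)) = f ∘ fun y => (t, y) from rfl, h4]
  simp

lemma hasDerivAt_time (hΩ : IsOpen Ω) (hf : DifferentiableOn ℝ f (Ioc 0 T ×ˢ closure Ω)) {t : ℝ}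
    (ht : t ∈ Ioo 0 T) {x : E ν} (hx : x ∈ Ω) :
    HasDerivAt (fun s => f (s, x)) (fderivWithin ℝ f (Ioc 0 T ×ˢ closure Ω) (t, x) (1, 0)) t := by
  have hn := cylinder_mem_nhds hΩ ht hx
  have h1 := (hf.differentiableAt hn).hasFDerivAt
  rw [fderivWithin_of_mem_nhds hn]
  exact h1.comp_hasDerivAt t ((hasDerivAt_id t).prodMk (hasDerivAt_const t x))

/-- Time and space derivatives commute. -/
lemma hasDerivAt_pderiv (hΩ : IsOpen Ω) {f : ℝ × E ν → ℝ}
    (hf : ContDiffOn ℝ ∞ f (Ioc 0 T ×ˢ closure Ω)) {t : ℝ} (ht : t ∈ Ioo 0 T) {x : E ν}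
    (hx : x ∈ Ω) (j : Fin ν) :
    HasDerivAt (fun s => pderiv j (fun y => f (s, y)) x)
      (pderiv j (fun y => fderivWithin ℝ f (Ioc 0 T ×ˢ closure Ω) (t, y) (1, 0)) x) t := by
  have hcda : ContDiffAt ℝ ∞ f (t, x) := hf.contDiffAt (cylinder_mem_nhds hΩ ht hx)
  have hd : HasFDerivAt (fderiv ℝ f) (fderiv ℝ (fderiv ℝ f) (t, x)) (t, x) :=
    (hcda.fderiv_right (m := ∞) le_rfl).differentiableAt_top.hasFDerivAt
  have hsymm : IsSymmSndFDerivAt ℝ f (t, x) :=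
    hcda.isSymmSndFDerivAt (by
      rw [minSmoothness_of_isRCLikeNormedField]; exact WithTop.coe_le_coe.2 le_top)
  have h1 : ∀ s ∈ Ioo 0 T, pderiv j (fun y => f (s, y)) x
      = fderiv ℝ f (s, x) (0, EuclideanSpace.single j 1) := by
    intro s hs
    have h1 := ((hf.contDiffAt (cylinder_mem_nhds hΩ hs hx)).differentiableAt_top).hasFDerivAt
    have h2 := (h1.comp x (hasFDerivAt_prodMk_right s x)).fderiv
    rw [pderiv, show (fun y => f (s, y)) = f ∘ fun y => (s, y) from rfl, h2]
    simp
  have h2 : (fun s => pderiv j (fun y => f (s, y)) x) =ᶠ[𝓝 t]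
      fun s => fderiv ℝ f (s, x) (0, EuclideanSpace.single j 1) :=
    mem_of_superset (isOpen_Ioo.mem_nhds ht) h1
  have h3 : pderiv j (fun y => fderivWithin ℝ f (Ioc 0 T ×ˢ closure Ω) (t, y) (1, 0)) x
      = fderiv ℝ (fderiv ℝ f) (t, x) (1, 0) (0, EuclideanSpace.single j 1) := by
    have he : (fun y => fderivWithin ℝ f (Ioc 0 T ×ˢ closure Ω) (t, y) (1, 0)) =ᶠ[𝓝 x]
        fun y => fderiv ℝ f (t, y) (1, 0) := by
      filter_upwards [hΩ.mem_nhds hx] with y hy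
      rw [fderivWithin_of_mem_nhds (cylinder_mem_nhds hΩ ht hy)]
    have h4 := ((hd.comp x (hasFDerivAt_prodMk_right t x)).clm_apply
      (hasFDerivAt_const ((1 : ℝ), (0 : E ν)) x)).fderiv
    rw [pderiv_congr j he, pderiv]
    refine (congrArg (fun L => L (EuclideanSpace.single j 1)) h4).trans ?_
    simp only [ContinuousLinearMap.comp_zero, zero_add]
    exact hsymm.eq _ _
  rw [h3]
  refine HasDerivAt.congr_of_eventuallyEq ?_ h2
  have h5 := hd.comp_hasDerivAt t ((hasDerivAt_id t).prodMk (hasDerivAt_const t x))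
  simpa using h5.clm_apply (hasDerivAt_const t ((0 : ℝ), EuclideanSpace.single j (1 : ℝ)))

/-- Nothing is known as time tends to `0`, so bounds come from compactness of the cylinder over `[a,
T]`; the applications take `a = t / 2`. -/
lemma exists_bound_cylinder (hb : Bornology.IsBounded Ω) {g : ℝ × E ν → ℝ}
    (hg : ContinuousOn g (Ioc 0 T ×ˢ closure Ω)) {a : ℝ} (ha : 0 < a) :
    ∃ C, ∀ t ∈ Icc a T, ∀ x ∈ Ω, ‖g (t, x)‖ ≤ C := by
  have hcomp : IsCompact (Icc a T ×ˢ closure Ω) := isCompact_Icc.prod hb.isCompact_closure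
  obtain ⟨C, hC⟩ := hcomp.exists_bound_of_continuousOn
    (hg.mono (prod_mono_left fun t ht => ⟨ha.trans_le ht.1, ht.2⟩))
  exact ⟨C, fun t ht x hx => hC (t, x) ⟨ht, subset_closure hx⟩⟩

lemma integrableOn_slice (hb : Bornology.IsBounded Ω) {g : ℝ × E ν → ℝ}
    (hg : ContinuousOn g (Ioc 0 T ×ˢ closure Ω)) {t : ℝ} (ht : t ∈ Ioc 0 T) :
    IntegrableOn (fun x => g (t, x)) Ω :=
  integrableOn_of_continuousOn_closure hb (continuousOn_slice hg ht)

lemma integrableOn_const_of_isBounded (hb : Bornology.IsBounded Ω) (C : ℝ) :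
    IntegrableOn (fun _ : E ν => C) Ω :=
  integrableOn_const hb.measure_lt_top.ne

lemma continuousOn_integral_slice (hΩ : IsOpen Ω) (hb : Bornology.IsBounded Ω)
    {g : ℝ × E ν → ℝ} (hg : ContinuousOn g (Ioc 0 T ×ˢ closure Ω)) :
    ContinuousOn (fun t => ∫ x in Ω, g (t, x)) (Ioc 0 T) := by
  intro t ht
  have ha : 0 < t / 2 := half_pos ht.1
  obtain ⟨C, hC⟩ := exists_bound_cylinder hb hg ha
  have hsub : Icc (t / 2) T ⊆ Ioc 0 T := fun s hs => ⟨ha.trans_le hs.1, hs.2⟩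
  have h1 : ContinuousOn (fun t => ∫ x in Ω, g (t, x)) (Icc (t / 2) T) := by
    refine continuousOn_of_dominated (bound := fun _ => C)
      (fun s hs => (integrableOn_slice hb hg (hsub hs)).aestronglyMeasurable)
      (fun s hs => ?_) (integrableOn_const_of_isBounded hb C) ?_
    · exact (ae_restrict_iff' hΩ.measurableSet).2 (Eventually.of_forall fun x hx => hC s hs x hx)
    · refine (ae_restrict_iff' hΩ.measurableSet).2 (Eventually.of_forall fun x hx => ?_)
      exact hg.comp (Continuous.continuousOn (by fun_prop)) fun s hs =>
        ⟨hsub hs, subset_closure hx⟩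
  refine (h1 t ⟨by linarith [ht.1], ht.2⟩).mono_of_mem_nhdsWithin ?_
  filter_upwards [self_mem_nhdsWithin,
    mem_nhdsWithin_of_mem_nhds (lt_mem_nhds (half_lt_self ht.1))] with s h1 h2
  exact ⟨h2.le, h1.2⟩

lemma hasDerivAt_integral_slice (hΩ : IsOpen Ω) (hb : Bornology.IsBounded Ω)
    (hud : UniqueDiffOn ℝ (closure Ω)) {g : ℝ × E ν → ℝ}
    (hg : ContDiffOn ℝ 1 g (Ioc 0 T ×ˢ closure Ω)) {t : ℝ} (ht : t ∈ Ioo 0 T) :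
    HasDerivAt (fun t => ∫ x in Ω, g (t, x))
      (∫ x in Ω, fderivWithin ℝ g (Ioc 0 T ×ˢ closure Ω) (t, x) (1, 0)) t := by
  have ha : 0 < t / 2 := half_pos ht.1
  have hg' : ContinuousOn (fun z => fderivWithin ℝ g (Ioc 0 T ×ˢ closure Ω) z (1, 0))
      (Ioc 0 T ×ˢ closure Ω) :=
    (hg.continuousOn_fderivWithin (uniqueDiffOn_cylinder hud) le_rfl).clm_apply continuousOn_const
  obtain ⟨C, hC⟩ := exists_bound_cylinder hb hg' ha
  have hsub : Ioo (t / 2) T ⊆ Ioo 0 T := Ioo_subset_Ioo_left ha.le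
  have htm : t ∈ Ioo (t / 2) T := ⟨half_lt_self ht.1, ht.2⟩
  refine (hasDerivAt_integral_of_dominated_loc_of_deriv_le (bound := fun _ => C)
    (F := fun s x => g (s, x)) (μ := volume.restrict Ω)
    (F' := fun s x => fderivWithin ℝ g (Ioc 0 T ×ˢ closure Ω) (s, x) (1, 0))
    (isOpen_Ioo.mem_nhds htm) ?_ (integrableOn_slice hb hg.continuousOn (Ioo_subset_Ioc_self ht))
    (integrableOn_slice hb hg' (Ioo_subset_Ioc_self ht)).aestronglyMeasurable ?_
    (integrableOn_const_of_isBounded hb C) ?_).2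
  · filter_upwards [isOpen_Ioo.mem_nhds ht] with s hs
    exact (integrableOn_slice hb hg.continuousOn (Ioo_subset_Ioc_self hs)).aestronglyMeasurable
  · exact (ae_restrict_iff' hΩ.measurableSet).2 (Eventually.of_forall fun x hx s hs =>
      hC s (Ioo_subset_Icc_self hs) x hx)
  · exact (ae_restrict_iff' hΩ.measurableSet).2 (Eventually.of_forall fun x hx s hs =>
      hasDerivAt_time hΩ (hg.differentiableOn one_ne_zero) (hsub hs) hx)

end Cylinder

/-! ### Energy balance of smooth solutions -/

section Balance

variable {ν : ℕ} {D : Data} {U : Fields ν} {Ω : Set (E ν)} {T : ℝ}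

lemma norm_gradient_sq (f : E ν → ℝ) (x : E ν) : ‖gradient f x‖ ^ 2 = ∑ j, pderiv j f x ^ 2 := by
  rw [← real_inner_self_eq_norm_sq, inner_eq_sum]
  simp only [gradient_coord, sq]

lemma gradientWithin_coord (f : E ν → ℝ) (s : Set (E ν)) (y : E ν) (j : Fin ν) :
    gradientWithin f s y j = fderivWithin ℝ f s y (EuclideanSpace.single j 1) := by
  rw [← inner_gradientWithin_left, EuclideanSpace.inner_single_right]
  simp

lemma gradientWithin_of_mem_nhds {f : E ν → ℝ} {s : Set (E ν)} {y : E ν} (hs : s ∈ 𝓝 y) :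
    gradientWithin f s y = gradient f y := by
  rw [gradientWithin, gradient, fderivWithin_of_mem_nhds hs]

lemma contDiffOn_fderivWithin_apply {X F : Type*} [NormedAddCommGroup X] [NormedSpace ℝ X]
    [NormedAddCommGroup F] [NormedSpace ℝ F] {f : X → F} {s : Set X}
    (hf : ContDiffOn ℝ ∞ f s) (hs : UniqueDiffOn ℝ s) (w : X) :
    ContDiffOn ℝ ∞ (fun z => fderivWithin ℝ f s z w) s :=
  (hf.fderivWithin hs (m := ∞) le_rfl).clm_apply contDiffOn_const

lemma contDiffOn_gradientWithin {f : E ν → ℝ} {s : Set (E ν)} (hf : ContDiffOn ℝ ∞ f s)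
    (hs : UniqueDiffOn ℝ s) : ContDiffOn ℝ ∞ (gradientWithin f s) s :=
  contDiffOn_euclidean.2 fun j => by
    simpa only [gradientWithin_coord] using contDiffOn_fderivWithin_apply hf hs _

/-- Keeps the argument of the drag within its interval of continuity: the endpoints `-δ` and `1 + δ`
are sent to `δ + 2 δ²` and `1 + δ - 2 δ²`. -/
lemma phiF_mem_Ioo (D : Data) {r : ℝ} (hr : r ∈ Ioo (-D.δ) (1 + D.δ)) :
    2 * D.δ + (1 - 2 * D.δ) * r ∈ Ioo 0 (1 + D.δ) := by
  have h1 := D.δ_pos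
  have h2 := D.δ_lt
  have h3 : 0 < 1 - 2 * D.δ := by linarith
  have h4 := mul_lt_mul_of_pos_left hr.1 h3
  have h5 := mul_lt_mul_of_pos_left hr.2 h3
  constructor <;> nlinarith

lemma contDiffOn_energyFlux (D : Data) {s : Set (E ν)} {n : WithTop ℕ∞} {p φ μ ψ : E ν → ℝ}
    {v gφ gμ : E ν → E ν} {S : E ν → Matrix (Fin ν) (Fin ν) ℝ} (hp : ContDiffOn ℝ n p s)
    (hφ : ContDiffOn ℝ n φ s) (hμ : ContDiffOn ℝ n μ s) (hψ : ContDiffOn ℝ n ψ s)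
    (hv : ContDiffOn ℝ n v s) (hgφ : ContDiffOn ℝ n gφ s) (hgμ : ContDiffOn ℝ n gμ s)
    (hS : ∀ i j, ContDiffOn ℝ n (fun y => S y i j) s) :
    ContDiffOn ℝ n (fun y => energyFlux D (p y) (φ y) (μ y) (ψ y) (v y) (gφ y) (gμ y) (S y)) s := by
  have hSv : ContDiffOn ℝ n (fun y => WithLp.toLp 2 ((S y).mulVec (v y))) s := by
    refine contDiffOn_euclidean.2 fun i => ?_
    simp only [Matrix.mulVec, dotProduct]
    exact ContDiffOn.sum fun j _ => (hS i j).mul ((contDiffOn_euclidean.1 hv) j)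
  have hn : ContDiffOn ℝ n (fun y => ‖v y‖ ^ 2) s := hv.norm_sq ℝ
  unfold energyFlux
  fun_prop

/-- The extension of the energy density to the closed cylinder. -/
noncomputable def energyDensityExt (D : Data) (U : Fields ν) (Ω : Set (E ν)) (T : ℝ)
    (z : ℝ × E ν) : ℝ :=
  1 / 2 * (D.ρ * U.φ z.1 z.2 + D.ρ * D.δ) * ‖U.v z.1 z.2‖ ^ 2
    + D.σ * (D.W (U.φ z.1 z.2) / D.ε + D.ε / 2 * ∑ j, (fderivWithin ℝ (fun z => U.φ z.1 z.2)
      (Ioc 0 T ×ˢ closure Ω) z (0, EuclideanSpace.single j 1)) ^ 2)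

/-- The extension of the Jacobian matrix of the velocity to the closed cylinder. -/
noncomputable def velocityJacExt (U : Fields ν) (Ω : Set (E ν)) (T : ℝ) (z : ℝ × E ν)
    (i j : Fin ν) : ℝ :=
  fderivWithin ℝ (fun z => U.v z.1 z.2) (Ioc 0 T ×ˢ closure Ω) z (0, EuclideanSpace.single j 1) i

/-- The extension of the dissipation rate to the closed cylinder. -/
noncomputable def energyRateExt (D : Data) (U : Fields ν) (Ω : Set (E ν)) (T : ℝ)
    (z : ℝ × E ν) : ℝ :=
  -(2 * D.γ * ∑ i, ∑ j, 1 / 2 * (velocityJacExt U Ω T z i j + velocityJacExt U Ω T z j i)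
      * velocityJacExt U Ω T z i j)
    - D.ρ * D.d (2 * D.δ + (1 - 2 * D.δ) * U.φ z.1 z.2) * ‖U.v z.1 z.2‖ ^ 2
    - D.σ * D.M * D.ε * ∑ j, (fderivWithin ℝ (fun z => U.μ z.1 z.2)
      (Ioc 0 T ×ˢ closure Ω) z (0, EuclideanSpace.single j 1)) ^ 2

namespace IsSmoothSolution

lemma contDiffOn_energyDensityExt (hU : IsSmoothSolution D U Ω T)
    (hud : UniqueDiffOn ℝ (closure Ω)) :
    ContDiffOn ℝ 1 (energyDensityExt D U Ω T) (Ioc 0 T ×ˢ closure Ω) := by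
  have h1 : (1 : WithTop ℕ∞) ≤ ∞ := by exact_mod_cast le_top
  have hφ := hU.smooth_φ.of_le h1
  have hv := hU.smooth_v.of_le h1
  have hW : ContDiffOn ℝ 1 (fun z : ℝ × E ν => D.W (U.φ z.1 z.2)) (Ioc 0 T ×ˢ closure Ω) :=
    D.W_contDiffOn.comp hφ fun z hz => hU.range_φ z.1 hz.1 z.2 hz.2
  have hd : ∀ j : Fin ν, ContDiffOn ℝ 1 (fun z => fderivWithin ℝ (fun z => U.φ z.1 z.2)
      (Ioc 0 T ×ˢ closure Ω) z (0, EuclideanSpace.single j 1)) (Ioc 0 T ×ˢ closure Ω) := fun j =>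
    (contDiffOn_fderivWithin_apply hU.smooth_φ (uniqueDiffOn_cylinder hud) _).of_le h1
  exact ((contDiffOn_const.mul ((contDiffOn_const.mul hφ).add contDiffOn_const)).mul
    (hv.norm_sq ℝ)).add (contDiffOn_const.mul ((hW.div_const _).add
      (contDiffOn_const.mul (ContDiffOn.sum fun j _ => (hd j).pow 2))))

lemma continuousOn_energyRateExt (hU : IsSmoothSolution D U Ω T)
    (hud : UniqueDiffOn ℝ (closure Ω)) :
    ContinuousOn (energyRateExt D U Ω T) (Ioc 0 T ×ˢ closure Ω) := by
  have hS := uniqueDiffOn_cylinder (T := T) hud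
  have hφ := hU.smooth_φ.continuousOn
  have hv := hU.smooth_v.continuousOn
  have hd : ContinuousOn (fun z : ℝ × E ν => D.d (2 * D.δ + (1 - 2 * D.δ) * U.φ z.1 z.2))
      (Ioc 0 T ×ˢ closure Ω) :=
    D.d_continuousOn.comp (continuousOn_const.add (continuousOn_const.mul hφ)) fun z hz =>
      Ioo_subset_Icc_self (phiF_mem_Ioo D (hU.range_φ z.1 hz.1 z.2 hz.2))
  have hJ : ∀ i j : Fin ν,
      ContinuousOn (fun z => velocityJacExt U Ω T z i j) (Ioc 0 T ×ˢ closure Ω) :=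
    fun i j => ((contDiffOn_euclidean.1
      (contDiffOn_fderivWithin_apply hU.smooth_v hS _)) i).continuousOn
  have hμ : ∀ j : Fin ν, ContinuousOn (fun z => fderivWithin ℝ (fun z => U.μ z.1 z.2)
      (Ioc 0 T ×ˢ closure Ω) z (0, EuclideanSpace.single j 1)) (Ioc 0 T ×ˢ closure Ω) := fun j =>
    (contDiffOn_fderivWithin_apply hU.smooth_μ hS _).continuousOn
  unfold energyRateExt
  fun_prop

lemma pderiv_eq_fderivWithin {f : ℝ → E ν → ℝ} (hΩ : IsOpen Ω) (hud : UniqueDiffOn ℝ (closure Ω))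
    (hf : ContDiffOn ℝ ∞ (fun z : ℝ × E ν => f z.1 z.2) (Ioc 0 T ×ˢ closure Ω)) {t : ℝ}
    (ht : t ∈ Ioc 0 T) {x : E ν} (hx : x ∈ Ω) (j : Fin ν) :
    pderiv j (f t) x = fderivWithin ℝ (fun z : ℝ × E ν => f z.1 z.2) (Ioc 0 T ×ˢ closure Ω) (t, x)
      (0, EuclideanSpace.single j 1) := by
  rw [← fderivWithin_slice hud (hf.differentiableOn (by simp)) ht (subset_closure hx),
    fderivWithin_of_mem_nhds (closure_mem_nhds hΩ hx)]
  rfl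

lemma energyDensity_eq (hU : IsSmoothSolution D U Ω T) (hΩ : IsOpen Ω)
    (hud : UniqueDiffOn ℝ (closure Ω)) {t : ℝ} (ht : t ∈ Ioc 0 T) {x : E ν} (hx : x ∈ Ω) :
    energyDensity D U t x = energyDensityExt D U Ω T (t, x) := by
  simp only [energyDensity, glDensity, rhoFTilde, rhoF, energyDensityExt, norm_gradient_sq,
    pderiv_eq_fderivWithin hΩ hud hU.smooth_φ ht hx]

lemma energyRate_eq (hU : IsSmoothSolution D U Ω T) (hΩ : IsOpen Ω)
    (hud : UniqueDiffOn ℝ (closure Ω)) {t : ℝ} (ht : t ∈ Ioc 0 T) {x : E ν} (hx : x ∈ Ω) :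
    energyRate D U t x = energyRateExt D U Ω T (t, x) := by
  have hv : ∀ i j : Fin ν, pderiv j (fun y => U.v t y i) x
      = fderivWithin ℝ (fun z : ℝ × E ν => U.v z.1 z.2) (Ioc 0 T ×ˢ closure Ω) (t, x)
        (0, EuclideanSpace.single j 1) i := by
    intro i j
    have hn := closure_mem_nhds hΩ hx
    have hd := hU.smooth_v.differentiableOn (by simp)
    have hdx : DifferentiableAt ℝ (U.v t) x :=
      ((contDiffOn_slice hU.smooth_v ht).contDiffAt hn).differentiableAt_top
    rw [pderiv, fderiv_coord hdx, ← fderivWithin_slice hud hd ht (subset_closure hx),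
      fderivWithin_of_mem_nhds hn]
  simp only [energyRate, energyRateExt, velocityJacExt, norm_gradient_sq, frob, symGrad_apply, jac,
    Matrix.of_apply, phiF, hv, pderiv_eq_fderivWithin hΩ hud hU.smooth_μ ht hx]

/-- The energy flux at time `t`, extended to the closure of the domain. -/
noncomputable def energyFluxExt (D : Data) (U : Fields ν) (Ω : Set (E ν)) (T t : ℝ) (x : E ν) :
    E ν :=
  energyFlux D (U.p t x) (U.φ t x) (U.μ t x)
    (fderivWithin ℝ (fun z : ℝ × E ν => U.φ z.1 z.2) (Ioc 0 T ×ˢ closure Ω) (t, x) (1, 0))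
    (U.v t x) (gradientWithin (U.φ t) (closure Ω) x) (gradientWithin (U.μ t) (closure Ω) x)
    (Matrix.of fun i j => 1 / 2 *
      (fderivWithin ℝ (U.v t) (closure Ω) x (EuclideanSpace.single j 1) i
        + fderivWithin ℝ (U.v t) (closure Ω) x (EuclideanSpace.single i 1) j))

lemma contDiffOn_energyFluxExt (hU : IsSmoothSolution D U Ω T) (hud : UniqueDiffOn ℝ (closure Ω))
    {t : ℝ} (ht : t ∈ Ioc 0 T) : ContDiffOn ℝ 1 (energyFluxExt D U Ω T t) (closure Ω) := by
  refine ContDiffOn.of_le (n := ∞) ?_ (by exact_mod_cast le_top)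
  have hp := contDiffOn_slice hU.smooth_p ht
  have hφ := contDiffOn_slice hU.smooth_φ ht
  have hμ := contDiffOn_slice hU.smooth_μ ht
  have hv := contDiffOn_slice hU.smooth_v ht
  have hψ := contDiffOn_slice (contDiffOn_fderivWithin_apply hU.smooth_φ
    (uniqueDiffOn_cylinder hud) ((1 : ℝ), (0 : E ν))) ht
  have hgφ := contDiffOn_gradientWithin hφ hud
  have hgμ := contDiffOn_gradientWithin hμ hud
  have hJ : ∀ i j : Fin ν, ContDiffOn ℝ ∞ (fun y => fderivWithin ℝ (U.v t) (closure Ω) y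
      (EuclideanSpace.single j 1) i) (closure Ω) := fun i j =>
    (contDiffOn_euclidean.1 (contDiffOn_fderivWithin_apply hv hud _)) i
  exact contDiffOn_energyFlux D hp hφ hμ hψ hv hgφ hgμ fun i j =>
    contDiffOn_const.mul ((hJ i j).add (hJ j i))

lemma integral_div_energyFluxExt (hU : IsSmoothSolution D U Ω T)
    (hΩ : IsBoundedLipschitzDomain Ω) {t : ℝ} (ht : t ∈ Ioo 0 T) :
    ∫ x in Ω, div (energyFluxExt D U Ω T t) x = 0 :=
  hΩ.integral_div_eq_zero
    (hU.contDiffOn_energyFluxExt hΩ.uniqueDiffOn_closure (Ioo_subset_Ioc_self ht))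
    fun z hz n hn => inner_energyFlux_eq_zero D _ _ _ _ _ (hU.noSlip t ht z hz)
      (hU.neumann_φ t ht z hz n hn) (hU.neumann_μ t ht z hz n hn)

/-- The local energy balance. -/
lemma hasDerivAt_energyDensity (hU : IsSmoothSolution D U Ω T) (hΩ : IsOpen Ω) {t : ℝ}
    (ht : t ∈ Ioo 0 T) {x : E ν} (hx : x ∈ Ω) :
    HasDerivAt (fun s => energyDensity D U s x)
      (energyRate D U t x + div (energyFluxExt D U Ω T t) x) t := by
  have ht' := Ioo_subset_Ioc_self ht
  have hn := closure_mem_nhds hΩ hx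
  set ψ : E ν → ℝ := fun y => fderivWithin ℝ (fun z : ℝ × E ν => U.φ z.1 z.2)
    (Ioc 0 T ×ˢ closure Ω) (t, y) (1, 0) with hψ_def
  have hfφ := hU.smooth_φ.differentiableOn (by simp)
  have hfv := hU.smooth_v.differentiableOn (by simp)
  have hp : ContDiffAt ℝ ∞ (U.p t) x := (contDiffOn_slice hU.smooth_p ht').contDiffAt hn
  have hφ : ContDiffAt ℝ ∞ (U.φ t) x := (contDiffOn_slice hU.smooth_φ ht').contDiffAt hn
  have hμ : ContDiffAt ℝ ∞ (U.μ t) x := (contDiffOn_slice hU.smooth_μ ht').contDiffAt hn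
  have hv : ContDiffAt ℝ ∞ (U.v t) x := (contDiffOn_slice hU.smooth_v ht').contDiffAt hn
  have hψ : ContDiffAt ℝ ∞ ψ x := by
    have h1 : ContDiffAt ℝ ∞ (fderiv ℝ fun z : ℝ × E ν => U.φ z.1 z.2) (t, x) :=
      (hU.smooth_φ.contDiffAt (cylinder_mem_nhds hΩ ht hx)).fderiv_right (m := ∞) le_rfl
    have h2 : ContDiffAt ℝ ∞ (fun y : E ν => (t, y)) x := contDiffAt_const.prodMk contDiffAt_id
    refine ((h1.comp x h2).clm_apply
      (contDiffAt_const (c := ((1 : ℝ), (0 : E ν))))).congr_of_eventuallyEq ?_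
    filter_upwards [hΩ.mem_nhds hx] with y hy
    simp only [hψ_def, fderivWithin_of_mem_nhds (cylinder_mem_nhds hΩ ht hy), Function.comp]
  have dφ : HasDerivAt (fun s => U.φ s x) (ψ x) t := hasDerivAt_time hΩ hfφ ht hx
  obtain ⟨a, dv⟩ : ∃ a, HasDerivAt (fun s => U.v s x) a t := ⟨_, hasDerivAt_time hΩ hfv ht hx⟩
  have dW : HasDerivAt (fun s => D.W (U.φ s x)) (deriv D.W (U.φ t x) * ψ x) t := by
    have hm := hU.range_φ t ht' x (subset_closure hx)
    have h1 := ((D.W_contDiffOn.differentiableOn one_ne_zero).differentiableAt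
      (isOpen_Ioo.mem_nhds hm)).hasDerivAt
    exact h1.comp t dφ
  have dρ : HasDerivAt (fun s => D.ρ * U.φ s x + D.ρ * D.δ) (D.ρ * ψ x) t :=
    (dφ.const_mul D.ρ).add_const _
  have hdiv : div (energyFluxExt D U Ω T t) x = div (fun y => energyFlux D (U.p t y) (U.φ t y)
      (U.μ t y) (ψ y) (U.v t y) (gradient (U.φ t) y) (gradient (U.μ t) y) (symGrad (U.v t) y)) x := by
    -- Inside the open set `Ω` one-sided and full derivatives agree, so the two fluxes coincide near
    -- `x`.
    refine div_congr ?_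
    filter_upwards [hΩ.mem_nhds hx] with y hy
    have hny := closure_mem_nhds hΩ hy
    have hvy : DifferentiableAt ℝ (U.v t) y :=
      ((contDiffOn_slice hU.smooth_v ht').contDiffAt hny).differentiableAt_top
    have hS : (Matrix.of fun i j => 1 / 2 *
      (fderivWithin ℝ (U.v t) (closure Ω) y (EuclideanSpace.single j 1) i
        + fderivWithin ℝ (U.v t) (closure Ω) y (EuclideanSpace.single i 1) j))
        = symGrad (U.v t) y := by
      ext i j
      rw [symGrad_apply, Matrix.of_apply, fderivWithin_of_mem_nhds hny, pderiv, pderiv,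
        fderiv_coord hvy, fderiv_coord hvy]
    simp only [energyFluxExt, hS, gradientWithin_of_mem_nhds hny, hψ_def]
  have hmom := hU.momentum t ht x hx
  rw [show deriv (fun s => rhoFTilde D U s x • U.v s x) t
      = (D.ρ * ψ x) • U.v t x + (D.ρ * U.φ t x + D.ρ * D.δ) • a by
    rw [add_comm]; exact (dρ.smul dv).deriv] at hmom
  have hph := hU.phase t ht x hx
  rw [dφ.deriv] at hph
  have key := energyRate_add_div_energyFlux D hp hφ hμ hψ hv a (D.d (phiF D U t x))
    (deriv D.W (U.φ t x)) (hU.incompressibility t ht x hx) hmom hph (hU.potential t ht x hx)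
  rw [hdiv, energyRate, ← key]
  have dg : HasDerivAt (fun s => ‖gradient (U.φ s) x‖ ^ 2)
      (2 * ⟪gradient (U.φ t) x, gradient ψ x⟫_ℝ) t := by
    simp only [norm_gradient_sq, inner_eq_sum, gradient_coord, Finset.mul_sum]
    refine HasDerivAt.fun_sum fun j _ => ?_
    refine HasDerivAt.congr_deriv ((hasDerivAt_pderiv hΩ hU.smooth_φ ht hx j).pow 2) ?_
    simp only [hψ_def, Nat.cast_ofNat]
    ring
  have dn : HasDerivAt (fun s => ‖U.v s x‖ ^ 2) (2 * ⟪U.v t x, a⟫_ℝ) t := dv.norm_sq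
  have hfin := ((dρ.const_mul (1 / 2)).mul dn).add
    (((dW.div_const D.ε).add (dg.const_mul (D.ε / 2))).const_mul D.σ)
  refine HasDerivAt.congr_deriv hfin ?_
  ring

/-- Differentiation under the integral yields the time derivative of the extended density;
uniqueness of derivatives identifies it pointwise with the local balance, whose flux integrates to
zero. -/
lemma hasDerivAt_freeEnergy (hU : IsSmoothSolution D U Ω T) (hΩ : IsBoundedLipschitzDomain Ω)
    {t : ℝ} (ht : t ∈ Ioo 0 T) :
    HasDerivAt (freeEnergy D U Ω) (∫ x in Ω, energyRate D U t x) t := by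
  have hud := hΩ.uniqueDiffOn_closure
  have hC1 := hU.contDiffOn_energyDensityExt hud
  have h1 := hasDerivAt_integral_slice hΩ.isOpen hΩ.isBounded hud hC1 ht
  have hF : freeEnergy D U Ω =ᶠ[𝓝 t] fun t => ∫ x in Ω, energyDensityExt D U Ω T (t, x) := by
    filter_upwards [isOpen_Ioo.mem_nhds ht] with s hs
    exact setIntegral_congr_fun hΩ.isOpen.measurableSet fun x hx =>
      hU.energyDensity_eq hΩ.isOpen hud (Ioo_subset_Ioc_self hs) hx
  have hrate : IntegrableOn (energyRate D U t) Ω :=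
    (integrableOn_slice hΩ.isBounded (hU.continuousOn_energyRateExt hud)
      (Ioo_subset_Ioc_self ht)).congr_fun
      (fun x hx => (hU.energyRate_eq hΩ.isOpen hud (Ioo_subset_Ioc_self ht) hx).symm)
      hΩ.isOpen.measurableSet
  have hflux := integrableOn_div hΩ.isOpen hΩ.isBounded hud
    (hU.contDiffOn_energyFluxExt hud (Ioo_subset_Ioc_self ht))
  have hval : ∫ x in Ω, fderivWithin ℝ (energyDensityExt D U Ω T) (Ioc 0 T ×ˢ closure Ω)
      (t, x) (1, 0) = ∫ x in Ω, energyRate D U t x := by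
    have h0 := integral_add hrate hflux
    rw [hU.integral_div_energyFluxExt hΩ ht, add_zero] at h0
    rw [← h0]
    refine setIntegral_congr_fun hΩ.isOpen.measurableSet fun x hx => ?_
    have h2 := hasDerivAt_time hΩ.isOpen (hC1.differentiableOn one_ne_zero) ht hx
    refine (h2.congr_of_eventuallyEq ?_).unique (hU.hasDerivAt_energyDensity hΩ.isOpen ht hx)
    filter_upwards [isOpen_Ioo.mem_nhds ht] with s hs
    exact hU.energyDensity_eq hΩ.isOpen hud (Ioo_subset_Ioc_self hs) hx
  rw [← hval]
  exact h1.congr_of_eventuallyEq hF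

lemma hasDerivWithinAt_freeEnergy (hU : IsSmoothSolution D U Ω T)
    (hΩ : IsBoundedLipschitzDomain Ω) {t : ℝ} (ht : t ∈ Ioc 0 T) :
    HasDerivWithinAt (freeEnergy D U Ω) (∫ x in Ω, energyRate D U t x) (Ioc 0 T) t := by
  have hud := hΩ.uniqueDiffOn_closure
  rcases ht.2.lt_or_eq with hlt | rfl
  · exact (hU.hasDerivAt_freeEnergy hΩ ⟨ht.1, hlt⟩).hasDerivWithinAt
  -- At the final time the equations are not available. Continuity of the energy and of the
  -- dissipation integral up to that time turns the limit of the derivatives into the left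
  -- derivative.
  have hF : ContinuousOn (freeEnergy D U Ω) (Ioc 0 t) :=
    (continuousOn_integral_slice hΩ.isOpen hΩ.isBounded
      (hU.contDiffOn_energyDensityExt hud).continuousOn).congr fun s hs =>
      setIntegral_congr_fun hΩ.isOpen.measurableSet fun x hx =>
        hU.energyDensity_eq hΩ.isOpen hud hs hx
  have hR : ContinuousOn (fun s => ∫ x in Ω, energyRate D U s x) (Ioc 0 t) :=
    (continuousOn_integral_slice hΩ.isOpen hΩ.isBounded
      (hU.continuousOn_energyRateExt hud)).congr fun s hs =>
      setIntegral_congr_fun hΩ.isOpen.measurableSet fun x hx =>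
        hU.energyRate_eq hΩ.isOpen hud hs hx
  have hmem : Ioo 0 t ∈ 𝓝[<] t := Ioo_mem_nhdsLT ht.1
  refine (hasDerivWithinAt_Iic_of_tendsto_deriv (s := Ioo 0 t)
    (fun s hs => (hU.hasDerivAt_freeEnergy hΩ hs).differentiableAt.differentiableWithinAt)
    ((hF t ht).mono Ioo_subset_Ioc_self) hmem ?_).mono Ioc_subset_Iic_self
  have hlim : Tendsto (fun s => ∫ x in Ω, energyRate D U s x) (𝓝[<] t)
      (𝓝 (∫ x in Ω, energyRate D U t x)) := by
    refine (hR t ht).tendsto.mono_left ?_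
    rw [nhdsWithin_le_iff]
    exact mem_of_superset hmem Ioo_subset_Ioc_self
  refine hlim.congr' ?_
  filter_upwards [hmem] with s hs
  exact (hU.hasDerivAt_freeEnergy hΩ hs).deriv.symm

end IsSmoothSolution

/-- The antisymmetric part of the Jacobian is orthogonal to the symmetric gradient, so the product
equals the squared Frobenius norm of the latter; averaging with the transposed sum shows this. -/
lemma frob_symGrad_jac_nonneg (v : E ν → E ν) (x : E ν) : 0 ≤ frob (symGrad v x) (jac v x) := by
  have h1 : frob (symGrad v x) (jac v x) = ∑ i, ∑ j, symGrad v x j i * jac v x j i :=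
    Finset.sum_comm
  have h2 : 2 * frob (symGrad v x) (jac v x) = 2 * ∑ i, ∑ j, symGrad v x i j ^ 2 := by
    rw [two_mul]
    nth_rewrite 2 [h1]
    rw [frob, ← Finset.sum_add_distrib, Finset.mul_sum]
    refine Finset.sum_congr rfl fun i _ => ?_
    rw [← Finset.sum_add_distrib, Finset.mul_sum]
    refine Finset.sum_congr rfl fun j _ => ?_
    simp only [symGrad_apply, jac, Matrix.of_apply]
    ring
  have h3 : 0 ≤ ∑ i, ∑ j, symGrad v x i j ^ 2 :=
    Finset.sum_nonneg fun i _ => Finset.sum_nonneg fun j _ => sq_nonneg _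
  linarith

lemma energyRate_nonpos {t : ℝ} {x : E ν} (hd : 0 ≤ D.d (phiF D U t x)) :
    energyRate D U t x ≤ 0 := by
  have h1 := mul_nonneg D.γ_pos.le (frob_symGrad_jac_nonneg (U.v t) x)
  have h2 := mul_nonneg (mul_nonneg D.ρ_pos.le hd) (sq_nonneg ‖U.v t x‖)
  have h3 := mul_nonneg (mul_nonneg (mul_nonneg D.σ_pos.le D.M_pos.le) D.ε_pos.le)
    (sq_nonneg ‖gradient (U.μ t) x‖)
  rw [energyRate]
  linarith

lemma drag_nonneg_of_le_one (D : Data) {s : ℝ} (hs : s ∈ Icc (0 : ℝ) 1) : 0 ≤ D.d s :=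
  D.d_one ▸ D.d_antitoneOn hs (right_mem_Icc.2 zero_le_one) hs.2

end Balance

end CHNS

/-- Energy dissipation for smooth solutions. The derivative in time is the one relative to `(0, T]`:
two-sided for `t < T` and one-sided at `t = T`. -/
theorem theorem1 {ν : ℕ} (hν : ν = 2 ∨ ν = 3) (D : CHNS.Data) (Ω : Set (CHNS.E ν))
    (hΩ : CHNS.IsBoundedLipschitzDomain Ω) (T : ℝ) (hT : 0 < T) (U : CHNS.Fields ν)
    (hU : CHNS.IsSmoothSolution D U Ω T) (t : ℝ) (ht : t ∈ Set.Ioc 0 T) :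
    MeasureTheory.IntegrableOn (CHNS.energyDensity D U t) Ω ∧
    MeasureTheory.IntegrableOn (CHNS.energyRate D U t) Ω ∧
    HasDerivWithinAt (CHNS.freeEnergy D U Ω) (∫ x in Ω, CHNS.energyRate D U t x)
      (Set.Ioc 0 T) t ∧
    (((∀ x ∈ Ω, U.φ t x ∈ Set.Icc 0 1) ∨ (∀ s ∈ Set.Icc 1 (1 + D.δ), 0 ≤ D.d s)) →
      ∫ x in Ω, CHNS.energyRate D U t x ≤ 0) := by
  have hud := hΩ.uniqueDiffOn_closure
  have hms := hΩ.isOpen.measurableSet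
  refine ⟨?_, ?_, hU.hasDerivWithinAt_freeEnergy hΩ ht, fun h => ?_⟩
  · exact (CHNS.integrableOn_slice hΩ.isBounded
      (hU.contDiffOn_energyDensityExt hud).continuousOn ht).congr_fun
      (fun x hx => (hU.energyDensity_eq hΩ.isOpen hud ht hx).symm) hms
  · exact (CHNS.integrableOn_slice hΩ.isBounded (hU.continuousOn_energyRateExt hud) ht).congr_fun
      (fun x hx => (hU.energyRate_eq hΩ.isOpen hud ht hx).symm) hms
  · refine setIntegral_nonpos hms fun x hx => CHNS.energyRate_nonpos ?_
    have hm : CHNS.phiF D U t x ∈ Ioo 0 (1 + D.δ) :=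
      CHNS.phiF_mem_Ioo D (hU.range_φ t ht x (subset_closure hx))
    rcases h with h | h
    -- For `φ` in `[0, 1]` the fluid fraction is a convex combination of `2 δ < 1` and `1`.
    · refine CHNS.drag_nonneg_of_le_one D ⟨hm.1.le, ?_⟩
      have h1 := (h x hx).2
      have h2 := D.δ_lt
      rw [CHNS.phiF]
      nlinarith
    · rcases le_total (CHNS.phiF D U t x) 1 with h1 | h1
      · exact CHNS.drag_nonneg_of_le_one D ⟨hm.1.le, h1⟩
      · exact h _ ⟨h1, hm.2.le⟩
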